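/- Let $\mathbb K\in\{\mathbb R,\mathbb C,\mathbb H,\mathbb O\}$ be a normed division algebra and $\mathbb K'\in\{\mathbb R',\mathbb C',\mathbb H',\mathbb O'\}$ a split composition algebra over $\mathbb R$, realized as $\mathbb C=\langle1,i\rangle$, $\mathbb H=\langle 1,i,j,k\rangle$ in the octonions $\mathbb O$ and $\mathbb C'=\langle1,L\rangle$, $\mathbb H'=\langle1,L,K,KL\rangle$ in the split octonions $\mathbb O'=\langle1,I,J,K,KL,JL,IL,L\rangle$ (in which $I^2=J^2=K^2=-1$ and $(KL)^2=(JL)^2=(IL)^2=L^2=1$). Let $\kappa=\dim\mathbb K$ and let $\kappa'_\pm$ be the number of basis units of $\mathbb K'$ of norm $\pm1$; thus $(\kappa'_+,\kappa'_-)=(1,0),(1,1),(2,2),(4,4)$. Write $\bar a$ and $A^\star$ for conjugation in $\mathbb K$ and in $\mathbb K'$. Let $$V_2=\left\{\mathbf X=\begin{pmatrix}A&\bar a\\a&-A^\star\end{pmatrix}: a\in\mathbb K,\ A\in\mathbb K'\right\},\qquad \Gamma(\mathbf X)=\begin{pmatrix}0&\mathbf X\\ \mathbf X-\mathrm{tr}(\mathbf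 X)\mathbf I&0\end{pmatrix},\qquad V_4=\Gamma(V_2),$$ matrices over $\mathbb K'\otimes\mathbb K$. Let $e_p$ run over the $\kappa+\kappa'_++\kappa'_-$ basis units of $\mathbb K$ and of $\mathbb K'$ (the unit $1$ of $\mathbb K$ and the unit $1$ of $\mathbb K'$ are different directions), let $\sigma_p\in V_2$ be the corresponding basis matrix, $\Gamma_p=\Gamma(\sigma_p)$, and $g_{pp}=|e_p|^2=\pm1$. For $p\ne q$ and $\theta\in\mathbb R$ define a map $T_{pq}(\theta)$ of $V_4$ as follows. (a) If $e_p,e_q$ commute, $T_{pq}(\theta)\mathbf P=\mathbf M\mathbf P\mathbf M^{-1}$ with $\mathbf M=\exp(-\Gamma_p\Gamma_q\,\theta/2)$, $\mathbf M^{-1}=\exp(\Gamma_p\Gamma_q\,\theta/2)$. (b) Otherwise $e_p,e_q$ anticommute, and $T_{pq}(\theta)\mathbf P=\mathbf M_2(\mathbf M_1\mathbf P\mathbf M_1^{-1})\mathbf M_2^{-1}$ (nested flips) with $\mathbf M_1=-e_p\mathbf I$ and $\mathbf M_2=(e_p\,c(\theta/2)+e_q\,s(\theta/2))\mathbf I$,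 where $(c,s)=(\cosh,\sinh)$ if $(e_pe_q)^2=1$ and $(c,s)=(\cos,\sin)$ if $(e_pe_q)^2=-1$. Then: 1. The displayed inverses are two-sided inverses, the triple products $\mathbf M\mathbf P\mathbf M^{-1}$, $\mathbf M_1\mathbf P\mathbf M_1^{-1}$ and $\mathbf M_2\mathbf P\mathbf M_2^{-1}$ with $\mathbf P\in V_4$ do not depend on the bracketing, and $T_{pq}(\theta)$ is an invertible linear transformation of $V_4$. It fixes $\Gamma_r$ for $r\ne p,q$, and on the $pq$-plane it is a rotation if $g_{pp}=g_{qq}$ and a boost if $g_{pp}\neq g_{qq}$: with $(c,s)=(\cos,\sin)$, respectively $(\cosh,\sinh)$, $$\Gamma_p\mapsto c(\theta)\Gamma_p+g_{pp}s(\theta)\Gamma_q,\quad \Gamma_q\mapsto c(\theta)\Gamma_q-g_{qq}s(\theta)\Gamma_p\qquad\text{in case (a)},$$ $$\Gamma_p\mapsto c(\theta)\Gamma_p+s(\theta)\Gamma_q,\quad \Gamma_q\mapsto c(\theta)\Gamma_q-g_{pp}g_{qq}s(\theta)\Gamma_p\qquad\text{in case (b)}.$$ 2. Under $\Gamma:V_2\to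 V_4$ the map $T_{pq}(\theta)$ corresponds to the invertible linear transformation of $V_2$ given by $\mathbf X\mapsto\exp(-\sigma_p\sigma_q^\star\theta/2)\,\mathbf X\,\exp(\sigma_p^\star\sigma_q\theta/2)$ in case (a), and by $\mathbf X\mapsto\mathbf M_2(\mathbf M_1\mathbf X\mathbf M_1^{-1})\mathbf M_2^{-1}$ (with the $2\times2$ identity matrix in $\mathbf M_1,\mathbf M_2$) in case (b). 3. In the coordinates given by the basis $\sigma_p$, one has $-\det\mathbf X=|A|^2+|a|^2$ and $\Gamma(\mathbf X)^2=(|A|^2+|a|^2)\mathbf I$, a form of signature $(\kappa+\kappa'_+,\kappa'_-)$. The transformations $T_{pq}(\theta)$ (all $p\neq q$, all $\theta$) generate exactly the group $SO_0(\kappa+\kappa'_+,\kappa'_-)$, the identity component of $SO(\kappa+\kappa'_+,\kappa'_-)$, acting faithfully on $V_4$ in the standard way; equivalently, the corresponding transformations of $V_2$ generate $SO_0(\kappa+\kappa'_+,\kappa'_-)$ acting in the standard way on $V_2$; this last group is called $SU(2,\mathbb K'\otimes\mathbb K)$. If $\kappa'_-=0$, then $SO_0(\kappa+\kappa'_+,0)=SO(\kappa+\kappa'_+)$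 is the full special orthogonal group. -/

import Mathlib

open scoped Quaternion TensorProduct Matrix

noncomputable section

namespace MagicSquare

/-! ### The octonions and the split octonions -/

/-- The real quaternion `a + b i + c j + d k`. -/
def quat (a b c d : ℝ) : ℍ[ℝ] := ⟨a, b, c, d⟩

@[simp] theorem quat_re (a b c d : ℝ) : (quat a b c d).re = a := rfl
@[simp] theorem quat_imI (a b c d : ℝ) : (quat a b c d).imI = b := rfl
@[simp] theorem quat_imJ (a b c d : ℝ) : (quat a b c d).imJ = c := rfl
@[simp] theorem quat_imK (a b c d : ℝ) : (quat a b c d).imK = d := rfl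

/-- The Cayley-Dickson double `ℍ ⊕ ℍ ℓ` of the real quaternions, with `ℓ ^ 2 = ε`.
The pair `⟨a, b⟩` is `a + b ℓ`. -/
@[ext]
structure CayleyDickson (ε : ℝ) : Type where
  fst : ℍ[ℝ]
  snd : ℍ[ℝ]

namespace CayleyDickson

variable {ε : ℝ}

instance : Add (CayleyDickson ε) := ⟨fun x y => ⟨x.fst + y.fst, x.snd + y.snd⟩⟩

instance : Zero (CayleyDickson ε) := ⟨⟨0, 0⟩⟩

instance : Neg (CayleyDickson ε) := ⟨fun x => ⟨-x.fst, -x.snd⟩⟩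

instance : SMul ℝ (CayleyDickson ε) := ⟨fun r x => ⟨r • x.fst, r • x.snd⟩⟩

/-- `(a + b ℓ) (c + d ℓ) = (a c + ε d̄ b) + (d a + b c̄) ℓ`. -/
instance : Mul (CayleyDickson ε) :=
  ⟨fun x y => ⟨x.fst * y.fst + ε • (star y.snd * x.snd), y.snd * x.fst + x.snd * star y.fst⟩⟩

instance : One (CayleyDickson ε) := ⟨⟨1, 0⟩⟩

@[simp] theorem add_fst (x y : CayleyDickson ε) : (x + y).fst = x.fst + y.fst := rfl
@[simp] theorem add_snd (x y : CayleyDickson ε) : (x + y).snd = x.snd + y.snd := rfl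
@[simp] theorem zero_fst : (0 : CayleyDickson ε).fst = 0 := rfl
@[simp] theorem zero_snd : (0 : CayleyDickson ε).snd = 0 := rfl
@[simp] theorem neg_fst (x : CayleyDickson ε) : (-x).fst = -x.fst := rfl
@[simp] theorem neg_snd (x : CayleyDickson ε) : (-x).snd = -x.snd := rfl
@[simp] theorem smul_fst (r : ℝ) (x : CayleyDickson ε) : (r • x).fst = r • x.fst := rfl
@[simp] theorem smul_snd (r : ℝ) (x : CayleyDickson ε) : (r • x).snd = r • x.snd := rfl
@[simp] theorem one_fst : (1 : CayleyDickson ε).fst = 1 := rfl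
@[simp] theorem one_snd : (1 : CayleyDickson ε).snd = 0 := rfl
@[simp] theorem mul_fst (x y : CayleyDickson ε) :
    (x * y).fst = x.fst * y.fst + ε • (star y.snd * x.snd) := rfl
@[simp] theorem mul_snd (x y : CayleyDickson ε) :
    (x * y).snd = y.snd * x.fst + x.snd * star y.fst := rfl

instance : NonAssocRing (CayleyDickson ε) where
  add_assoc x y z := by ext1 <;> simp only [add_fst, add_snd, add_assoc]
  zero_add x := by ext1 <;> simp only [add_fst, add_snd, zero_fst, zero_snd, zero_add]
  add_zero x := by ext1 <;> simp only [add_fst, add_snd, zero_fst, zero_snd, add_zero]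
  nsmul := nsmulRec
  zsmul := zsmulRec
  neg_add_cancel x := by
    ext1 <;> simp only [add_fst, add_snd, neg_fst, neg_snd, zero_fst, zero_snd, neg_add_cancel]
  add_comm x y := by ext1 <;> simp only [add_fst, add_snd, add_comm]
  left_distrib x y z := by
    ext1 <;> simp only [mul_fst, mul_snd, add_fst, add_snd, mul_add, add_mul, star_add,
      smul_add] <;> abel
  right_distrib x y z := by
    ext1 <;> simp only [mul_fst, mul_snd, add_fst, add_snd, mul_add, add_mul, smul_add] <;> abel
  zero_mul x := by ext1 <;> simp
  mul_zero x := by ext1 <;> simp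
  one_mul x := by ext1 <;> simp
  mul_one x := by ext1 <;> simp

instance : Module ℝ (CayleyDickson ε) where
  one_smul x := by ext1 <;> simp only [smul_fst, smul_snd, one_smul]
  mul_smul r s x := by ext1 <;> simp only [smul_fst, smul_snd, mul_smul]
  smul_zero r := by ext1 <;> simp only [smul_fst, smul_snd, zero_fst, zero_snd, smul_zero]
  smul_add r x y := by ext1 <;> simp only [smul_fst, smul_snd, add_fst, add_snd, smul_add]
  add_smul r s x := by ext1 <;> simp only [smul_fst, smul_snd, add_fst, add_snd, add_smul]
  zero_smul x := by ext1 <;> simp only [smul_fst, smul_snd, zero_fst, zero_snd, zero_smul]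

instance : IsScalarTower ℝ (CayleyDickson ε) (CayleyDickson ε) :=
  ⟨fun r x y => by
    ext1 <;> simp only [smul_eq_mul, mul_fst, mul_snd, smul_fst, smul_snd, smul_mul_assoc,
      mul_smul_comm, smul_add, smul_comm r ε]⟩

instance : SMulCommClass ℝ (CayleyDickson ε) (CayleyDickson ε) :=
  ⟨fun r x y => by
    ext1 <;> simp only [smul_eq_mul, mul_fst, mul_snd, smul_fst, smul_snd, smul_mul_assoc,
      mul_smul_comm, smul_add, Quaternion.star_smul, smul_comm r ε]⟩

/-- Conjugation `a + b ℓ ↦ ā - b ℓ`: it fixes `1` and negates the seven imaginary units. -/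
def conj : CayleyDickson ε →ₗ[ℝ] CayleyDickson ε where
  toFun x := ⟨star x.fst, -x.snd⟩
  map_add' x y := by ext1 <;> simp only [add_fst, add_snd, star_add, neg_add]
  map_smul' r x := by
    ext1 <;> simp only [smul_fst, smul_snd, Quaternion.star_smul, smul_neg, RingHom.id_apply]

/-- The basis `1, i, j, k, k ℓ, j ℓ, i ℓ, ℓ`, in this order. -/
def unit (ε : ℝ) : Fin 8 → CayleyDickson ε :=
  ![⟨quat 1 0 0 0, 0⟩, ⟨quat 0 1 0 0, 0⟩, ⟨quat 0 0 1 0, 0⟩, ⟨quat 0 0 0 1, 0⟩,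
    ⟨0, quat 0 0 0 1⟩, ⟨0, quat 0 0 1 0⟩, ⟨0, quat 0 1 0 0⟩, ⟨0, quat 1 0 0 0⟩]

end CayleyDickson

open CayleyDickson

/-- The octonions. -/
abbrev Oct : Type := CayleyDickson (-1)

/-- The split octonions. -/
abbrev SplitOct : Type := CayleyDickson 1

/-- Labels for the four normed division algebras and for their four split versions. -/
inductive Label : Type
  | R | C | H | O

/-- The positions, in the list `1, i, j, k, kℓ, jℓ, iℓ, ℓ`, of the basis units of the
division algebra: `ℝ = ⟨1⟩`, `ℂ = ⟨1, i⟩`, `ℍ = ⟨1, i, j, k⟩`, `𝕆`. -/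
def Label.divIdx : Label → Finset (Fin 8)
  | .R => {0}
  | .C => {0, 1}
  | .H => {0, 1, 2, 3}
  | .O => Finset.univ

/-- The positions, in the list `1, I, J, K, KL, JL, IL, L`, of the basis units of the
split algebra: `ℝ' = ⟨1⟩`, `ℂ' = ⟨1, L⟩`, `ℍ' = ⟨1, L, K, KL⟩`, `𝕆'`. -/
def Label.splitIdx : Label → Finset (Fin 8)
  | .R => {0}
  | .C => {0, 7}
  | .H => {0, 7, 3, 4}
  | .O => Finset.univ

/-- The dimension `κ` of the division algebra. -/
def Label.dim : Label → ℕ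
  | .R => 1
  | .C => 2
  | .H => 4
  | .O => 8

/-- The number `κ'₊` of basis units of positive norm of the split algebra. -/
def Label.pos : Label → ℕ
  | .R => 1
  | .C => 1
  | .H => 2
  | .O => 4

/-- The number `κ'₋` of basis units of negative norm of the split algebra. -/
def Label.neg : Label → ℕ
  | .R => 0
  | .C => 1
  | .H => 2
  | .O => 4

/-- The division algebra `𝕂`, as a subspace of `𝕆`. -/
def Label.div (k : Label) : Submodule ℝ Oct :=
  Submodule.span ℝ (unit (-1) '' (k.divIdx : Set (Fin 8)))

/-- The split algebra `𝕂'`, as a subspace of `𝕆'`. -/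
def Label.split (k : Label) : Submodule ℝ SplitOct :=
  Submodule.span ℝ (unit 1 '' (k.splitIdx : Set (Fin 8)))

/-! ### Matrices over `𝕆' ⊗ 𝕆` -/

/-- The nonassociative algebra `𝕆' ⊗ 𝕆`, which contains every `𝕂' ⊗ 𝕂`. -/
abbrev OO : Type := SplitOct ⊗[ℝ] Oct

/-- Conjugation of both factors. -/
def conjBoth : OO →ₗ[ℝ] OO := TensorProduct.map conj conj

/-- Conjugation of the split factor only. -/
def conjSplit : OO →ₗ[ℝ] OO := TensorProduct.map conj LinearMap.id

abbrev Mat2 : Type := Matrix (Fin 2) (Fin 2) OO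

/-- `4 × 4` matrices, in `2 × 2` blocks. -/
abbrev Mat4 : Type := Matrix (Fin 2 ⊕ Fin 2) (Fin 2 ⊕ Fin 2) OO

/-- The powers `I, A, A A, A (A A), …` of a matrix. -/
def mpow {n : Type} [Fintype n] [DecidableEq n] (A : Matrix n n OO) : ℕ → Matrix n n OO
  | 0 => 1
  | k + 1 => A * mpow A k

/-- The exponential series `∑ Aᵏ / k!`, in the canonical topology of the finite-dimensional real
vector space of matrices. -/
def mexp {n : Type} [Fintype n] [DecidableEq n] (A : Matrix n n OO) : Matrix n n OO :=
  letI : TopologicalSpace (Matrix n n OO) := moduleTopology ℝ (Matrix n n OO)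
  ∑' k : ℕ, ((k.factorial : ℝ)⁻¹) • mpow A k

/-- The scalar matrix `u I`. -/
def scalarMat {n : Type} [DecidableEq n] (u : OO) : Matrix n n OO := Matrix.diagonal fun _ => u

/-- The determinant of a `2 × 2` matrix (used only where the entries commute). -/
def det2 (X : Mat2) : OO := X 0 0 * X 1 1 - X 0 1 * X 1 0

/-! ### The spaces `V₂` and `V₄` -/

/-- `(A, a) ↦ (A, ā; a, -A⋆)`. -/
def vecMat : SplitOct × Oct →ₗ[ℝ] Mat2 where
  toFun x := !![x.1 ⊗ₜ[ℝ] 1, 1 ⊗ₜ[ℝ] conj x.2; 1 ⊗ₜ[ℝ] x.2, -(conj x.1 ⊗ₜ[ℝ] 1)]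
  map_add' x y := by
    ext i j
    fin_cases i <;> fin_cases j <;>
      simp [TensorProduct.add_tmul, TensorProduct.tmul_add, add_comm]
  map_smul' r x := by
    ext i j
    fin_cases i <;> fin_cases j <;> simp [TensorProduct.smul_tmul']

/-- Trace reversal `X ↦ X - tr(X) I`. -/
def traceRev : Mat2 →ₗ[ℝ] Mat2 where
  toFun X := X - scalarMat X.trace
  map_add' X Y := by
    ext i j
    by_cases h : i = j
    · simp only [scalarMat, Matrix.diagonal, h, Matrix.trace_add, Matrix.sub_apply,
        Matrix.add_apply, Matrix.of_apply, if_true]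
      abel
    · simp [scalarMat, Matrix.diagonal, h]
  map_smul' r X := by
    ext i j
    by_cases h : i = j <;> simp [scalarMat, Matrix.diagonal, h, smul_sub]

/-- `Γ(X) = (0, X; X̃, 0)`, where `X̃` is the trace reversal of `X`. -/
def Gam : Mat2 →ₗ[ℝ] Mat4 where
  toFun X := Matrix.fromBlocks 0 X (traceRev X) 0
  map_add' X Y := by simp [Matrix.fromBlocks_add]
  map_smul' r X := by simp [Matrix.fromBlocks_smul]

/-- `V₂`, for the pair `(𝕂', 𝕂)`. -/
def V2 (k' k : Label) : Submodule ℝ Mat2 := (k'.split.prod k.div).map vecMat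

/-- `V₄ = Γ(V₂)`. -/
def V4 (k' k : Label) : Submodule ℝ Mat4 := (V2 k' k).map Gam

/-! ### The basis units, the Pauli matrices and the gamma matrices -/

/-- The coordinate directions: the basis units of `𝕂` (left) and those of `𝕂'` (right). -/
abbrev Dir (k' k : Label) : Type := {i : Fin 8 // i ∈ k.divIdx} ⊕ {i : Fin 8 // i ∈ k'.splitIdx}

variable {k' k : Label}

/-- The basis unit `e_p`, as an element of `𝕆' ⊗ 𝕆`. -/
def e : Dir k' k → OO
  | .inl i => 1 ⊗ₜ[ℝ] unit (-1) i.1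
  | .inr i => unit 1 i.1 ⊗ₜ[ℝ] 1

/-- The generalized Pauli matrix `σ_p`. -/
def pauli : Dir k' k → Mat2
  | .inl i => vecMat (0, unit (-1) i.1)
  | .inr i => vecMat (unit 1 i.1, 0)

/-- The gamma matrix `Γ_p`. -/
def gam (p : Dir k' k) : Mat4 := Gam (pauli p)

/-- The norm `g_pp = ±1` of the direction `p`: it is `-1` exactly for `KL, JL, IL, L`. -/
def g : Dir k' k → ℝ
  | .inl _ => 1
  | .inr i => if i.1 < 4 then 1 else -1

/-! ### The two kinds of maps -/

/-- `M_pq = exp(-Γ_p Γ_q θ / 2)`. -/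
def expM (p q : Dir k' k) (θ : ℝ) : Mat4 := mexp (-((θ / 2) • (gam p * gam q)))

/-- `M_pq⁻¹ = exp(Γ_p Γ_q θ / 2)`. -/
def expMInv (p q : Dir k' k) (θ : ℝ) : Mat4 := mexp ((θ / 2) • (gam p * gam q))

/-- The Clifford exponential action `P ↦ M_pq P M_pq⁻¹`. -/
def expMap4 (p q : Dir k' k) (θ : ℝ) (P : Mat4) : Mat4 := (expM p q θ * P) * expMInv p q θ

/-- The exponential action on `2 × 2` matrices,
`X ↦ exp(-σ_p σ_q⋆ θ / 2) X exp(σ_p⋆ σ_q θ / 2)`. -/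
def expMap2 (p q : Dir k' k) (θ : ℝ) (X : Mat2) : Mat2 :=
  (mexp (-((θ / 2) • (pauli p * (pauli q).map conjSplit))) * X) *
    mexp ((θ / 2) • ((pauli p).map conjSplit * pauli q))

open scoped Classical in
/-- The scalar `e_p c(θ/2) + e_q s(θ/2)`, hyperbolic if `(e_p e_q)² = 1`, else trigonometric. -/
def flipUnit (p q : Dir k' k) (θ : ℝ) : OO :=
  if (e p * e q) * (e p * e q) = 1 then Real.cosh (θ / 2) • e p + Real.sinh (θ / 2) • e q
  else Real.cos (θ / 2) • e p + Real.sin (θ / 2) • e q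

section Flips

variable {n : Type} [Fintype n] [DecidableEq n]

/-- `M₁ = -e_p I`. -/
def flipM1 (p : Dir k' k) : Matrix n n OO := scalarMat (-e p)

/-- `M₂ = (e_p c(θ/2) + e_q s(θ/2)) I`. -/
def flipM2 (p q : Dir k' k) (θ : ℝ) : Matrix n n OO := scalarMat (flipUnit p q θ)

/-- `M₁⁻¹`, through the inverse `ū / |u|²` of the scalar `u`, for which `|u|² = g_pp`. -/
def flipM1Inv (p : Dir k' k) : Matrix n n OO := scalarMat ((g p)⁻¹ • conjBoth (-e p))

/-- `M₂⁻¹`, through the inverse `ū / |u|²` of the scalar `u`, for which `|u|² = g_pp`. -/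
def flipM2Inv (p q : Dir k' k) (θ : ℝ) : Matrix n n OO :=
  scalarMat ((g p)⁻¹ • conjBoth (flipUnit p q θ))

/-- The nested flip `P ↦ M₂ (M₁ P M₁⁻¹) M₂⁻¹`. -/
def nestedFlip (p q : Dir k' k) (θ : ℝ) (P : Matrix n n OO) : Matrix n n OO :=
  (flipM2 p q θ * ((flipM1 p * P) * flipM1Inv p)) * flipM2Inv p q θ

end Flips

open scoped Classical in
/-- The map attached to the `pq`-plane and to `θ`: the exponential action if `e_p` and `e_q`
commute, the nested flip if not. -/
def planeMap4 (p q : Dir k' k) (θ : ℝ) (P : Mat4) : Mat4 :=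
  if e p * e q = e q * e p then expMap4 p q θ P else nestedFlip p q θ P

open scoped Classical in
/-- The same on `2 × 2` matrices. -/
def planeMap2 (p q : Dir k' k) (θ : ℝ) (X : Mat2) : Mat2 :=
  if e p * e q = e q * e p then expMap2 p q θ X else nestedFlip p q θ X

/-- `cos θ` if the directions have the same sign (rotation), `cosh θ` if not (boost). -/
def cFun (p q : Dir k' k) (θ : ℝ) : ℝ := if g p = g q then Real.cos θ else Real.cosh θ

/-- `sin θ` if the directions have the same sign (rotation), `sinh θ` if not (boost). -/
def sFun (p q : Dir k' k) (θ : ℝ) : ℝ := if g p = g q then Real.sin θ else Real.sinh θ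

/-- The group of transformations of `V₄` generated by all the maps `planeMap4`. -/
def genGroup4 (k' k : Label) : Subgroup (V4 k' k ≃ₗ[ℝ] V4 k' k) :=
  Subgroup.closure {f | ∃ (p q : Dir k' k) (θ : ℝ), p ≠ q ∧
    ∀ P : V4 k' k, (f P : Mat4) = planeMap4 p q θ P}

/-- `SU(2, 𝕂' ⊗ 𝕂)`: the group of transformations of `V₂` generated by all the maps `planeMap2`. -/
def SU2 (k' k : Label) : Subgroup (V2 k' k ≃ₗ[ℝ] V2 k' k) :=
  Subgroup.closure {f | ∃ (p q : Dir k' k) (θ : ℝ), p ≠ q ∧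
    ∀ X : V2 k' k, (f X : Mat2) = planeMap2 p q θ X}

/-! ### The special orthogonal groups -/

/-- The standard quadratic form of signature `(m, n)`. -/
def stdForm {m n : ℕ} (x : Fin m ⊕ Fin n → ℝ) : ℝ :=
  ∑ i, x (Sum.inl i) ^ 2 - ∑ j, x (Sum.inr j) ^ 2

/-- `SO(m, n)`: the real matrices of determinant `1` that preserve the standard quadratic form of
signature `(m, n)`. -/
def SO (m n : ℕ) : Subgroup (GL (Fin m ⊕ Fin n) ℝ) where
  carrier := {A | (∀ x, stdForm (A.1 *ᵥ x) = stdForm x) ∧ A.1.det = 1}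
  one_mem' := by simp
  mul_mem' := by
    rintro A B ⟨hA, hA'⟩ ⟨hB, hB'⟩
    refine ⟨fun x => ?_, ?_⟩
    · rw [Units.val_mul, ← Matrix.mulVec_mulVec, hA, hB]
    · rw [Units.val_mul, Matrix.det_mul, hA', hB', one_mul]
  inv_mem' := by
    rintro A ⟨hA, hA'⟩
    refine ⟨fun x => ?_, ?_⟩
    · rw [← hA, Matrix.mulVec_mulVec, Units.mul_inv, Matrix.one_mulVec]
    · have h : (A.1 * (A⁻¹).1).det = 1 := by rw [Units.mul_inv, Matrix.det_one]
      rwa [Matrix.det_mul, hA', one_mul] at h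

/-- `SO₀(m, n)`: the connected component of the identity in `SO(m, n)`. -/
def SO0 (m n : ℕ) : Subgroup (GL (Fin m ⊕ Fin n) ℝ) :=
  (Subgroup.connectedComponentOfOne (SO m n)).map (SO m n).subtype

end MagicSquare

end

open MagicSquare

/-! The space `V₂` is the image under `vecMat` of `𝕂' ⊕ 𝕂` with the form `|A|² + |a|²`. The first
half of the proof computes every map `T_pq(θ)` in the coordinates of the basis `σ_p` and finds
that it is the plane rotation or boost `planeRot`; the second half shows that these generate
`SO₀`.

If `e_p` and `e_q` commute, then `B = Γ_p Γ_q` satisfies `B² = -g_pp g_qq`, so the exponential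
series is `c ± s B` (`mexp_smul_eq`). Nonassociativity does no harm, because for a commuting pair
the entries of `B` and of a third matrix `Γ(z)` involve only two elements of each factor of
`𝕆' ⊗ 𝕆`, and the alternative and flexible laws suffice. The relations needed are collected in
`CliffordPair` and proved for the three kinds of commuting pairs: one unit in each algebra, or the
unit `1` and an imaginary unit of the same algebra. They give `(c - s B) Γ(z) (c + s B)` in closed
form (`CliffordPair.conj_Gam`).

If `e_p` and `e_q` do not commute, they are distinct imaginary units of one algebra, hence
orthogonal, hence anticommuting. Conjugation by an imaginary element `u` of nonzero norm is the
map `x ↦ x̄ + 2 ⟨u, x⟩ u / |u|²`, and the composite of two such maps is a rotation of the plane of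
the two elements, by twice the angle between them (`conjBy_conjBy`). Up to the sign `orient p q`
of the angle, the outcome is the same as in the commuting case (`planeMap4_comb`,
`planeMap2_comb`).

The group generated by the plane rotations and boosts lies in the identity component of
`SO(m, n)`, each of them being joined to `1` by a path. Conversely, they reduce any `A ∈ SO(m, n)`
to a diagonal matrix `D` of signs: the image of a basis vector is moved to a coordinate axis by
killing its coordinates one after the other, and the later images stay orthogonal to the axes
already reached (`exists_mul_diagonal`). On the identity component the determinant of the upper
left `m × m` block is positive, as it does not vanish on `SO(m, n)`. So for `A ∈ SO₀(m, n)` the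
entries `-1` of `D` come in pairs of the same sign, and each pair is a rotation by `π`
(`le_planeGroup`). For `n = 0` the block is the whole matrix, and the argument applies to all of
`SO(m)`. -/

noncomputable section

namespace MagicSquare

open CayleyDickson

section Algebra

/-! ### Alternativity and the inner product -/

namespace CayleyDickson

variable {ε : ℝ}

/-- The inner product polarizing the norm form `|a + b ℓ|² = |a|² - ε |b|²`. -/
def ip (x y : CayleyDickson ε) : ℝ :=
  x.fst.re * y.fst.re + x.fst.imI * y.fst.imI + x.fst.imJ * y.fst.imJ + x.fst.imK * y.fst.imK
    - ε * (x.snd.re * y.snd.re + x.snd.imI * y.snd.imI + x.snd.imJ * y.snd.imJ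
      + x.snd.imK * y.snd.imK)

@[simp] theorem conj_fst (x : CayleyDickson ε) : (conj x).fst = star x.fst := rfl
@[simp] theorem conj_snd (x : CayleyDickson ε) : (conj x).snd = -x.snd := rfl

@[simp] theorem conj_conj (x : CayleyDickson ε) : conj (conj x) = x := by
  ext <;> simp

@[simp] theorem conj_one : conj (1 : CayleyDickson ε) = 1 := by
  ext <;> simp

theorem ip_comm (x y : CayleyDickson ε) : ip x y = ip y x := by
  simp only [ip]; ring

@[simp] theorem ip_add_left (x y z : CayleyDickson ε) : ip (x + y) z = ip x z + ip y z := by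
  simp [ip]; ring

@[simp] theorem ip_add_right (x y z : CayleyDickson ε) : ip x (y + z) = ip x y + ip x z := by
  simp [ip]; ring

@[simp] theorem ip_smul_left (r : ℝ) (x y : CayleyDickson ε) : ip (r • x) y = r * ip x y := by
  simp [ip]; ring

@[simp] theorem ip_smul_right (r : ℝ) (x y : CayleyDickson ε) : ip x (r • y) = r * ip x y := by
  simp [ip]; ring

@[simp] theorem ip_zero_left (x : CayleyDickson ε) : ip 0 x = 0 := by
  simp [ip]

@[simp] theorem ip_zero_right (x : CayleyDickson ε) : ip x 0 = 0 := by
  simp [ip]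

@[simp] theorem ip_neg_left (x y : CayleyDickson ε) : ip (-x) y = -ip x y := by
  simp [ip]; ring

@[simp] theorem ip_neg_right (x y : CayleyDickson ε) : ip x (-y) = -ip x y := by
  simp [ip]; ring

@[simp] theorem ip_one_one : ip (1 : CayleyDickson ε) 1 = 1 := by
  simp [ip]

@[simp] theorem ip_conj_conj (x y : CayleyDickson ε) : ip (conj x) (conj y) = ip x y := by
  simp [ip]

theorem conj_eq (x : CayleyDickson ε) : conj x = (2 * ip 1 x) • 1 - x := by
  rw [eq_sub_iff_add_eq]
  ext <;> simp [ip]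
  ring

theorem conj_mul_add (x y : CayleyDickson ε) :
    conj x * y + conj y * x = (2 * ip x y) • (1 : CayleyDickson ε) := by
  ext <;> simp [ip] <;> ring

theorem mul_conj_add (x y : CayleyDickson ε) :
    x * conj y + y * conj x = (2 * ip x y) • (1 : CayleyDickson ε) := by
  ext <;> simp [ip] <;> ring

theorem conj_mul_mul (x y : CayleyDickson ε) : conj x * (x * y) = ip x x • y := by
  ext <;> simp [ip] <;> ring

theorem mul_mul_conj (x y : CayleyDickson ε) : (y * x) * conj x = ip x x • y := by
  ext <;> simp [ip] <;> ring

theorem mul_conj_mul (x y : CayleyDickson ε) : x * (conj x * y) = ip x x • y := by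
  simpa using conj_mul_mul (conj x) y

theorem mul_conj_mul' (x y : CayleyDickson ε) : (y * conj x) * x = ip x x • y := by
  simpa using mul_mul_conj (conj x) y

theorem conj_mul_self (x : CayleyDickson ε) : conj x * x = ip x x • 1 := by
  simpa using conj_mul_mul x 1

theorem mul_conj_self (x : CayleyDickson ε) : x * conj x = ip x x • 1 := by
  simpa using mul_conj_mul x 1

theorem conj_mul (x y : CayleyDickson ε) : conj (x * y) = conj y * conj x := by
  ext <;> simp

theorem flexible (x y : CayleyDickson ε) : (x * y) * x = x * (y * x) := by
  ext <;> simp <;> ring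

end CayleyDickson

end Algebra

section Clifford

/-! ### Clifford relations -/

/-- Conjugation of the split component. On `V₂` it is trace reversal (`traceRev_vecMat`) and also
the operation `X⋆` (`map_conjSplit_vecMat`). -/
def tilde (z : SplitOct × Oct) : SplitOct × Oct := (conj z.1, z.2)

@[simp] theorem tilde_tilde (z : SplitOct × Oct) : tilde (tilde z) = z := by
  simp [tilde]

theorem vecMat_apply (z : SplitOct × Oct) :
    vecMat z = !![z.1 ⊗ₜ[ℝ] 1, 1 ⊗ₜ[ℝ] conj z.2; 1 ⊗ₜ[ℝ] z.2, -(conj z.1 ⊗ₜ[ℝ] 1)] := rfl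

theorem traceRev_vecMat (z : SplitOct × Oct) : traceRev (vecMat z) = vecMat (tilde z) := by
  ext i j
  fin_cases i <;> fin_cases j <;>
    simp [traceRev, vecMat_apply, scalarMat, Matrix.trace, tilde]

theorem map_conjSplit_vecMat (z : SplitOct × Oct) :
    (vecMat z).map conjSplit = vecMat (tilde z) := by
  ext i j
  fin_cases i <;> fin_cases j <;>
    simp [vecMat_apply, conjSplit, tilde]

theorem Gam_vecMat (z : SplitOct × Oct) :
    Gam (vecMat z) = Matrix.fromBlocks 0 (vecMat z) (vecMat (tilde z)) 0 := by
  rw [← traceRev_vecMat]; rfl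

/-- The inner product on `𝕆' ⊕ 𝕆`. -/
def form (x y : SplitOct × Oct) : ℝ := ip x.1 y.1 + ip x.2 y.2

@[simp] theorem form_tilde (x y : SplitOct × Oct) : form (tilde x) (tilde y) = form x y := by
  simp [form, tilde]

theorem form_comm (x y : SplitOct × Oct) : form x y = form y x := by
  simp only [form, ip_comm]

theorem vecMat_mul_tilde_add (x y : SplitOct × Oct) :
    vecMat x * vecMat (tilde y) + vecMat y * vecMat (tilde x) = (2 * form x y) • (1 : Mat2) := by
  have h1 := conj_mul_add x.1 y.1
  have h2 := conj_mul_add x.2 y.2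
  have h3 := mul_conj_add x.1 y.1
  have h4 := mul_conj_add x.2 y.2
  have e1 : conj x.2 * y.2 = (2 * ip x.2 y.2) • (1 : Oct) - conj y.2 * x.2 := by
    rw [← h2]; abel
  have e2 : x.2 * conj y.2 = (2 * ip x.2 y.2) • (1 : Oct) - y.2 * conj x.2 := by
    rw [← h4]; abel
  have e3 : conj x.1 * y.1 = (2 * ip x.1 y.1) • (1 : SplitOct) - conj y.1 * x.1 := by
    rw [← h1]; abel
  have e4 : x.1 * conj y.1 = (2 * ip x.1 y.1) • (1 : SplitOct) - y.1 * conj x.1 := by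
    rw [← h3]; abel
  ext i j
  fin_cases i <;> fin_cases j <;>
    simp [vecMat_apply, tilde, e1, e2, e3, e4, TensorProduct.sub_tmul, TensorProduct.tmul_sub,
      form, Algebra.TensorProduct.one_def, ← TensorProduct.smul_tmul'] <;> module

/-- The relations that make `(x, y)` behave like two orthogonal vectors of an associative
Clifford algebra, with respect to every third vector `z`. They are those of the upper right block
of `Γ(x) Γ(y) Γ(z)`, in which `Γ(x) Γ(y)` has the diagonal blocks `σ(x) σ(y)⋆` and `σ(x)⋆ σ(y)`;
those of the lower left block are the same for `(x⋆, y⋆)`. -/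
structure CliffordPair (x y : SplitOct × Oct) : Prop where
  sq : (vecMat x * vecMat (tilde y)) * (vecMat x * vecMat (tilde y)) =
    -((form x x * form y y) • (1 : Mat2))
  comm (z) : (vecMat x * vecMat (tilde y)) * vecMat z =
    vecMat z * (vecMat (tilde x) * vecMat y) +
      ((2 * form y z) • vecMat x - (2 * form x z) • vecMat y)
  assoc (z) : ((vecMat x * vecMat (tilde y)) * vecMat z) * (vecMat (tilde x) * vecMat y) =
    (vecMat x * vecMat (tilde y)) * (vecMat z * (vecMat (tilde x) * vecMat y))
  right (z) : (vecMat z * (vecMat (tilde x) * vecMat y)) * (vecMat (tilde x) * vecMat y) =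
    -((form x x * form y y) • vecMat z)
  fst : vecMat x * (vecMat (tilde x) * vecMat y) = form x x • vecMat y
  snd : vecMat y * (vecMat (tilde x) * vecMat y) = -(form y y • vecMat x)

/-- One element in each of the two algebras. -/
theorem cliffordPair_mixed (a : Oct) (A : SplitOct) : CliffordPair (0, a) (A, 0) := by
  have hU : ∀ (A : SplitOct), vecMat (0, a) * vecMat (tilde (A, 0)) =
      !![0, -(A ⊗ₜ[ℝ] conj a); conj A ⊗ₜ[ℝ] a, 0] := by
    intro A
    ext i j
    fin_cases i <;> fin_cases j <;> simp [vecMat_apply, tilde, Matrix.mul_apply, Fin.sum_univ_two]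
  have hL : vecMat (tilde (0, a)) * vecMat (A, 0) =
      !![0, -(conj A ⊗ₜ[ℝ] conj a); A ⊗ₜ[ℝ] a, 0] := by
    have := hU (conj A)
    simpa [tilde] using this
  constructor
  · rw [hU]
    ext i j
    fin_cases i <;> fin_cases j <;> simp [Matrix.mul_apply, Fin.sum_univ_two, conj_mul_self,
      mul_conj_self, form, Algebra.TensorProduct.one_def, ← TensorProduct.smul_tmul', smul_smul,
      mul_comm]
  · rintro ⟨C, c⟩
    rw [hU, hL]
    have e1 : conj a * c = (2 * ip a c) • (1 : Oct) - conj c * a := by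
      rw [← conj_mul_add]; abel
    have e2 : a * conj c = (2 * ip a c) • (1 : Oct) - c * conj a := by
      rw [← mul_conj_add]; abel
    have e3 : conj A * C = (2 * ip A C) • (1 : SplitOct) - conj C * A := by
      rw [← conj_mul_add]; abel
    have e4 : A * conj C = (2 * ip A C) • (1 : SplitOct) - C * conj A := by
      rw [← mul_conj_add]; abel
    ext i j
    fin_cases i <;> fin_cases j <;>
      simp [vecMat_apply, Matrix.mul_apply, Fin.sum_univ_two, form, e1, e2, e3, e4,
        TensorProduct.sub_tmul, TensorProduct.tmul_sub, ← TensorProduct.smul_tmul'] <;> module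
  · rintro ⟨C, c⟩
    rw [hU, hL]
    ext i j
    fin_cases i <;> fin_cases j <;>
      simp [vecMat_apply, Matrix.mul_apply, Fin.sum_univ_two, conj_mul_self, mul_conj_self,
        flexible]
  · rintro ⟨C, c⟩
    rw [hL]
    ext i j
    fin_cases i <;> fin_cases j <;>
      simp [vecMat_apply, Matrix.mul_apply, Fin.sum_univ_two, form, mul_mul_conj, mul_conj_mul',
        smul_smul, conj_mul_self, mul_conj_self, ← TensorProduct.smul_tmul', mul_comm]
  · rw [hL]
    ext i j
    fin_cases i <;> fin_cases j <;>
      simp [vecMat_apply, Matrix.mul_apply, Fin.sum_univ_two, form, conj_mul_self, mul_conj_self]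
  · rw [hL]
    ext i j
    fin_cases i <;> fin_cases j <;>
      simp [vecMat_apply, Matrix.mul_apply, Fin.sum_univ_two, form, conj_mul_self, mul_conj_self,
        ← TensorProduct.smul_tmul']

theorem cliffordPair_one_div {a : Oct} (ha : ip 1 a = 0) : CliffordPair (0, 1) (0, a) := by
  have hc : conj a = -a := by rw [conj_eq, ha]; simp
  have hU : vecMat (0, 1) * vecMat (tilde (0, a)) = !![1 ⊗ₜ[ℝ] a, 0; 0, -(1 ⊗ₜ[ℝ] a)] := by
    ext i j
    fin_cases i <;> fin_cases j <;>
      simp [vecMat_apply, tilde, Matrix.mul_apply, Fin.sum_univ_two, hc, TensorProduct.tmul_neg]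
  have hL : vecMat (tilde (0, 1)) * vecMat (0, a) = !![1 ⊗ₜ[ℝ] a, 0; 0, -(1 ⊗ₜ[ℝ] a)] := by
    rw [← hU]; simp [tilde]
  have hs : a * a = -(ip a a • 1) := by rw [← mul_conj_self, hc, mul_neg, neg_neg]
  have hr : ∀ c, (c * a) * a = -(ip a a • c) := by
    intro c; rw [← mul_mul_conj, hc, mul_neg, neg_neg]
  constructor
  · rw [hU]
    ext i j
    fin_cases i <;> fin_cases j <;> simp [Matrix.mul_apply, Fin.sum_univ_two, hs, form,
      Algebra.TensorProduct.one_def, TensorProduct.tmul_neg]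
  · rintro ⟨C, c⟩
    rw [hU, hL]
    have e1 : a * c = (2 * ip a c) • (-1 : Oct) + (2 * ip 1 c) • a + - (c * a) := by
      have := conj_mul_add a c
      rw [hc, conj_eq c, sub_mul, smul_mul_assoc, one_mul] at this
      rw [smul_neg, ← this]; simp; abel
    ext i j
    fin_cases i <;> fin_cases j <;>
      simp [vecMat_apply, Matrix.mul_apply, Fin.sum_univ_two, form, e1,
        TensorProduct.tmul_add, TensorProduct.tmul_neg, hc, conj_eq c, mul_sub, sub_mul,
        TensorProduct.tmul_sub, smul_mul_assoc, mul_smul_comm] <;> module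
  · rintro ⟨C, c⟩
    rw [hU, hL]
    ext i j
    fin_cases i <;> fin_cases j <;>
      simp [vecMat_apply, Matrix.mul_apply, Fin.sum_univ_two, flexible]
  · rintro ⟨C, c⟩
    rw [hL]
    ext i j
    fin_cases i <;> fin_cases j <;>
      simp [vecMat_apply, Matrix.mul_apply, Fin.sum_univ_two, form, hs, hr, TensorProduct.tmul_neg]
  · rw [hL]
    ext i j
    fin_cases i <;> fin_cases j <;>
      simp [vecMat_apply, Matrix.mul_apply, Fin.sum_univ_two, form, hc, TensorProduct.tmul_neg]
  · rw [hL]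
    ext i j
    fin_cases i <;> fin_cases j <;>
      simp [vecMat_apply, Matrix.mul_apply, Fin.sum_univ_two, form, hs, hc, TensorProduct.tmul_neg]

theorem cliffordPair_one_split {A : SplitOct} (hA : ip 1 A = 0) : CliffordPair (1, 0) (A, 0) := by
  have hc : conj A = -A := by rw [conj_eq, hA]; simp
  have hU : vecMat (1, 0) * vecMat (tilde (A, 0)) = !![-(A ⊗ₜ[ℝ] 1), 0; 0, A ⊗ₜ[ℝ] 1] := by
    ext i j
    fin_cases i <;> fin_cases j <;>
      simp [vecMat_apply, tilde, Matrix.mul_apply, Fin.sum_univ_two, hc, TensorProduct.neg_tmul]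
  have hL : vecMat (tilde (1, 0)) * vecMat (A, 0) = !![A ⊗ₜ[ℝ] 1, 0; 0, -(A ⊗ₜ[ℝ] 1)] := by
    ext i j
    fin_cases i <;> fin_cases j <;>
      simp [vecMat_apply, tilde, Matrix.mul_apply, Fin.sum_univ_two, hc, TensorProduct.neg_tmul]
  have hs : A * A = -(ip A A • 1) := by rw [← mul_conj_self, hc, mul_neg, neg_neg]
  have hr : ∀ c, (c * A) * A = -(ip A A • c) := by
    intro c; rw [← mul_mul_conj, hc, mul_neg, neg_neg]
  constructor
  · rw [hU]
    ext i j
    fin_cases i <;> fin_cases j <;> simp [Matrix.mul_apply, Fin.sum_univ_two, hs, form,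
      Algebra.TensorProduct.one_def, TensorProduct.neg_tmul, ← TensorProduct.smul_tmul']
  · rintro ⟨C, c⟩
    rw [hU, hL]
    have e1 : A * C = (2 * ip A C) • (-1 : SplitOct) + (2 * ip 1 C) • A + - (C * A) := by
      have := conj_mul_add A C
      rw [hc, conj_eq C, sub_mul, smul_mul_assoc, one_mul] at this
      rw [smul_neg, ← this]; simp; abel
    ext i j
    fin_cases i <;> fin_cases j <;>
      simp [vecMat_apply, Matrix.mul_apply, Fin.sum_univ_two, form, e1,
        TensorProduct.add_tmul, TensorProduct.neg_tmul, hc, conj_eq C, mul_sub, sub_mul,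
        TensorProduct.sub_tmul, ← TensorProduct.smul_tmul', smul_mul_assoc, mul_smul_comm] <;>
        module
  · rintro ⟨C, c⟩
    rw [hU, hL]
    ext i j
    fin_cases i <;> fin_cases j <;>
      simp [vecMat_apply, Matrix.mul_apply, Fin.sum_univ_two, flexible]
  · rintro ⟨C, c⟩
    rw [hL]
    ext i j
    fin_cases i <;> fin_cases j <;>
      simp [vecMat_apply, Matrix.mul_apply, Fin.sum_univ_two, form, hs, hr, TensorProduct.neg_tmul,
        ← TensorProduct.smul_tmul']
  · rw [hL]
    ext i j
    fin_cases i <;> fin_cases j <;>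
      simp [vecMat_apply, Matrix.mul_apply, Fin.sum_univ_two, form, hc, TensorProduct.neg_tmul]
  · rw [hL]
    ext i j
    fin_cases i <;> fin_cases j <;>
      simp [vecMat_apply, Matrix.mul_apply, Fin.sum_univ_two, form, hs, hc, TensorProduct.neg_tmul,
        ← TensorProduct.smul_tmul']
theorem vecMat_mul_tilde_swap {x y : SplitOct × Oct} (h : form x y = 0) :
    vecMat y * vecMat (tilde x) = -(vecMat x * vecMat (tilde y)) := by
  have := vecMat_mul_tilde_add x y
  rw [h, mul_zero, zero_smul, add_comm] at this
  exact eq_neg_of_add_eq_zero_left this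

theorem CliffordPair.symm {x y : SplitOct × Oct} (h : CliffordPair x y) (hxy : form x y = 0) :
    CliffordPair y x := by
  have h1 := vecMat_mul_tilde_swap hxy
  have h2 := vecMat_mul_tilde_swap (x := tilde x) (y := tilde y) (by rwa [form_tilde])
  simp only [tilde_tilde] at h2
  constructor
  · rw [h1, neg_mul_neg, h.sq, mul_comm (form x x)]
  · intro z
    rw [h1, h2, neg_mul, h.comm, mul_neg]
    abel
  · intro z
    rw [h1, h2, neg_mul, neg_mul_neg, h.assoc, mul_neg, neg_mul_neg]
  · intro z
    rw [h2, mul_neg, mul_neg, neg_mul, neg_neg, h.right, mul_comm (form x x)]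
  · rw [h2, mul_neg, h.snd, neg_neg]
  · rw [h2, mul_neg, h.fst]

section NonAssoc

variable {R : Type*} [NonAssocRing R] [Module ℝ R] [IsScalarTower ℝ R R] [SMulCommClass ℝ R R]

theorem add_smul_mul_sub_smul {B : R} {n c s : ℝ} (hB : B * B = -(n • (1 : R)))
    (h : c ^ 2 + n * s ^ 2 = 1) : (c • 1 + s • B) * (c • 1 - s • B) = 1 := by
  have : (c • 1 + s • B) * (c • 1 - s • B) = (c ^ 2 + n * s ^ 2) • (1 : R) := by
    simp only [mul_sub, add_mul, smul_mul_assoc, mul_smul_comm, one_mul, mul_one, hB]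
    module
  rw [this, h, one_smul]

theorem sub_smul_mul_add_smul {B : R} {n c s : ℝ} (hB : B * B = -(n • (1 : R)))
    (h : c ^ 2 + n * s ^ 2 = 1) : (c • 1 - s • B) * (c • 1 + s • B) = 1 := by
  have := add_smul_mul_sub_smul (c := c) (s := -s) hB (by rwa [neg_sq])
  rwa [neg_smul, ← sub_eq_add_neg, sub_neg_eq_add] at this

theorem sub_smul_mul_mul_add_smul {B P W W' : R} {n c s : ℝ} (h : c ^ 2 + n * s ^ 2 = 1)
    (hc : B * P = P * B + W) (hr : (P * B) * B = -(n • P)) (hW : W * B = W') :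
    ((c • 1 - s • B) * P) * (c • 1 + s • B) = P - (c * s) • W - s ^ 2 • W' := by
  have : ((c • 1 - s • B) * P) * (c • 1 + s • B) =
      (c ^ 2 + n * s ^ 2) • P - (c * s) • W - s ^ 2 • W' := by
    simp only [mul_add, sub_mul, add_mul, smul_mul_assoc, mul_smul_comm, one_mul, mul_one, hc, hr,
      hW]
    module
  rw [this, h, one_smul]

theorem sub_smul_mul_mul_add_smul_assoc {B P : R} {c s : ℝ} (h : (B * P) * B = B * (P * B)) :
    ((c • 1 - s • B) * P) * (c • 1 + s • B) = (c • 1 - s • B) * (P * (c • 1 + s • B)) := by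
  simp only [mul_add, sub_mul, smul_mul_assoc, mul_smul_comm, one_mul, mul_one, h]

end NonAssoc

theorem Gam_mul_Gam (x y : SplitOct × Oct) : Gam (vecMat x) * Gam (vecMat y) =
    Matrix.fromBlocks (vecMat x * vecMat (tilde y)) 0 0 (vecMat (tilde x) * vecMat y) := by
  simp [Gam_vecMat, Matrix.fromBlocks_multiply]

theorem Gam_sq (x : SplitOct × Oct) :
    Gam (vecMat x) * Gam (vecMat x) = form x x • (1 : Mat4) := by
  have h : ∀ x, vecMat x * vecMat (tilde x) = form x x • (1 : Mat2) := by
    intro x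
    have := vecMat_mul_tilde_add x x
    have h2 : (2 : ℝ) • (vecMat x * vecMat (tilde x)) = (2 : ℝ) • (form x x • (1 : Mat2)) := by
      rw [two_smul, this, smul_smul]
    exact smul_right_injective _ (two_ne_zero' ℝ) h2
  have h' := h (tilde x)
  rw [tilde_tilde, form_tilde] at h'
  rw [Gam_mul_Gam, h, h', ← Matrix.fromBlocks_one, Matrix.fromBlocks_smul, smul_zero]

/-- The map of `𝕆' ⊕ 𝕆` that conjugation `P ↦ (c - s B) P (c + s B)` with `B = Γ(x) Γ(y)` induces
for a Clifford pair `(x, y)`. -/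
def spinRot (x y : SplitOct × Oct) (c s : ℝ) (z : SplitOct × Oct) : SplitOct × Oct :=
  z - (c * s) • ((2 * form y z) • x - (2 * form x z) • y) -
    s ^ 2 • ((2 * form y z * form x x) • y + (2 * form x z * form y y) • x)

namespace CliffordPair

variable {x y : SplitOct × Oct} (h : CliffordPair x y) (h' : CliffordPair (tilde x) (tilde y))
include h h'

theorem Gam_sq : (Gam (vecMat x) * Gam (vecMat y)) * (Gam (vecMat x) * Gam (vecMat y)) =
    -((form x x * form y y) • (1 : Mat4)) := by
  have e := h'.sq
  simp only [tilde_tilde, form_tilde] at e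
  rw [Gam_mul_Gam, Matrix.fromBlocks_multiply, ← Matrix.fromBlocks_one, Matrix.fromBlocks_smul,
    Matrix.fromBlocks_neg]
  simp [h.sq, e]

theorem Gam_comm (z : SplitOct × Oct) :
    (Gam (vecMat x) * Gam (vecMat y)) * Gam (vecMat z) =
      Gam (vecMat z) * (Gam (vecMat x) * Gam (vecMat y)) +
        ((2 * form y z) • Gam (vecMat x) - (2 * form x z) • Gam (vecMat y)) := by
  have e := h'.comm (tilde z)
  simp only [tilde_tilde, form_tilde] at e
  rw [Gam_mul_Gam]
  simp only [Gam_vecMat, Matrix.fromBlocks_multiply, Matrix.fromBlocks_smul, sub_eq_add_neg,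
    Matrix.fromBlocks_neg, Matrix.fromBlocks_add]
  simp [h.comm, e, sub_eq_add_neg]

theorem Gam_assoc (z : SplitOct × Oct) :
    ((Gam (vecMat x) * Gam (vecMat y)) * Gam (vecMat z)) * (Gam (vecMat x) * Gam (vecMat y)) =
      (Gam (vecMat x) * Gam (vecMat y)) * (Gam (vecMat z) * (Gam (vecMat x) * Gam (vecMat y))) := by
  have e := h'.assoc (tilde z)
  simp only [tilde_tilde] at e
  rw [Gam_mul_Gam, Gam_vecMat z]
  simp [Matrix.fromBlocks_multiply, h.assoc, e]

theorem Gam_right (z : SplitOct × Oct) :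
    (Gam (vecMat z) * (Gam (vecMat x) * Gam (vecMat y))) * (Gam (vecMat x) * Gam (vecMat y)) =
      -((form x x * form y y) • Gam (vecMat z)) := by
  have e := h'.right (tilde z)
  simp only [tilde_tilde, form_tilde] at e
  rw [Gam_mul_Gam, Gam_vecMat z]
  simp [Matrix.fromBlocks_multiply, Matrix.fromBlocks_smul, Matrix.fromBlocks_neg, h.right, e]

theorem Gam_fst : Gam (vecMat x) * (Gam (vecMat x) * Gam (vecMat y)) =
    form x x • Gam (vecMat y) := by
  have e := h'.fst
  simp only [tilde_tilde, form_tilde] at e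
  rw [Gam_mul_Gam, Gam_vecMat x, Gam_vecMat y]
  simp [Matrix.fromBlocks_multiply, Matrix.fromBlocks_smul, h.fst, e]

theorem Gam_snd : Gam (vecMat y) * (Gam (vecMat x) * Gam (vecMat y)) =
    -(form y y • Gam (vecMat x)) := by
  have e := h'.snd
  simp only [tilde_tilde, form_tilde] at e
  rw [Gam_mul_Gam, Gam_vecMat x, Gam_vecMat y]
  simp [Matrix.fromBlocks_multiply, Matrix.fromBlocks_smul, Matrix.fromBlocks_neg, h.snd, e]

theorem conj_Gam {c s : ℝ} (hcs : c ^ 2 + (form x x * form y y) * s ^ 2 = 1)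
    (z : SplitOct × Oct) :
    ((c • 1 - s • (Gam (vecMat x) * Gam (vecMat y))) * Gam (vecMat z)) *
      (c • 1 + s • (Gam (vecMat x) * Gam (vecMat y))) = Gam (vecMat (spinRot x y c s z)) := by
  rw [sub_smul_mul_mul_add_smul hcs (h.Gam_comm h' z) (h.Gam_right h' z) rfl, sub_mul,
    smul_mul_assoc, smul_mul_assoc, h.Gam_fst h', h.Gam_snd h', spinRot]
  simp only [map_sub, map_add, map_smul]
  module

end CliffordPair

end Clifford

section Units

/-! ### The orthogonal basis of units -/

namespace CayleyDickson

variable {ε : ℝ}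

theorem unit_zero : unit ε 0 = 1 := by
  ext <;> simp [unit]

theorem ip_unit_unit (i j : Fin 8) :
    ip (unit ε i) (unit ε j) = if i = j then if i < 4 then 1 else -ε else 0 := by
  fin_cases i <;> fin_cases j <;> simp [unit, ip]

/-- Two orthogonal imaginary elements anticommute. -/
theorem mul_eq_neg_mul {x y : CayleyDickson ε} (hx : ip 1 x = 0) (hy : ip 1 y = 0)
    (hxy : ip x y = 0) : x * y = -(y * x) := by
  have h := conj_mul_add x y
  rw [conj_eq x, conj_eq y, hx, hy, hxy] at h
  simp only [mul_zero, zero_smul, zero_sub, neg_mul] at h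
  rw [← sub_eq_zero, ← neg_eq_zero, ← h]; abel

/-- Orthogonal imaginary elements of nonzero norm do not commute. -/
theorem mul_ne_mul {x y : CayleyDickson ε} (hx : ip 1 x = 0) (hy : ip 1 y = 0)
    (hxy : ip x y = 0) (hxx : ip x x ≠ 0) (hyy : ip y y ≠ 0) : x * y ≠ y * x := by
  intro h
  have h0 : x * y = 0 := by
    have h1 := mul_eq_neg_mul hx hy hxy
    rw [← h] at h1
    have h2 : (2 : ℝ) • (x * y) = 0 := by rw [two_smul]; nth_rewrite 1 [h1]; simp
    exact (smul_eq_zero.1 h2).resolve_left two_ne_zero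
  have h1 := conj_mul_mul x y
  rw [h0, mul_zero] at h1
  have h2 : y = 0 := (smul_eq_zero.1 h1.symm).resolve_left hxx
  exact hyy (by simp [h2])

/-- The real part, as a linear form. -/
def reForm : CayleyDickson ε →ₗ[ℝ] ℝ where
  toFun x := ip 1 x
  map_add' := ip_add_right 1
  map_smul' r x := by simp

theorem reForm_one : reForm (1 : CayleyDickson ε) = 1 := ip_one_one

end CayleyDickson

theorem one_tmul_injective : Function.Injective fun x : Oct => (1 : SplitOct) ⊗ₜ[ℝ] x := by
  intro x y h
  have := congrArg (TensorProduct.lid ℝ Oct ∘ TensorProduct.map reForm LinearMap.id) h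
  simpa [reForm_one] using this

theorem tmul_one_injective : Function.Injective fun x : SplitOct => x ⊗ₜ[ℝ] (1 : Oct) := by
  intro x y h
  have := congrArg (TensorProduct.rid ℝ SplitOct ∘ TensorProduct.map LinearMap.id reForm) h
  simpa [reForm_one] using this

theorem vecMat_injective : Function.Injective vecMat := by
  intro x y h
  have h0 := congrFun (congrFun h 0) 0
  have h1 := congrFun (congrFun h 1) 0
  exact Prod.ext (tmul_one_injective (by simpa [vecMat_apply] using h0))
    (one_tmul_injective (by simpa [vecMat_apply] using h1))

theorem Gam_injective : Function.Injective Gam := fun _ _ h => (Matrix.fromBlocks_inj.1 h).2.1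

variable {k' k : Label}

/-- The element of `𝕆' ⊕ 𝕆` given by the unit in the direction `p`. -/
def vec : Dir k' k → SplitOct × Oct
  | .inl i => (0, unit (-1) i.1)
  | .inr i => (unit 1 i.1, 0)

theorem pauli_eq (p : Dir k' k) : pauli p = vecMat (vec p) := by
  cases p <;> rfl

theorem gam_eq (p : Dir k' k) : gam p = Gam (vecMat (vec p)) := by
  rw [gam, pauli_eq]

theorem form_vec_vec (p q : Dir k' k) : form (vec p) (vec q) = if p = q then g p else 0 := by
  rcases p with ⟨i, hi⟩ | ⟨i, hi⟩ <;> rcases q with ⟨j, hj⟩ | ⟨j, hj⟩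
  · simp only [form, vec, g, ip_unit_unit, ip_zero_left, Sum.inl.injEq, Subtype.mk.injEq]
    split_ifs <;> norm_num
  · simp [form, vec]
  · simp [form, vec]
  · simp only [form, vec, g, ip_unit_unit, ip_zero_left, Sum.inr.injEq, Subtype.mk.injEq, add_zero]

theorem form_vec_self (p : Dir k' k) : form (vec p) (vec p) = g p := by simp [form_vec_vec]

theorem form_vec_of_ne {p q : Dir k' k} (h : p ≠ q) : form (vec p) (vec q) = 0 := by
  simp [form_vec_vec, h]

theorem g_mul_self (p : Dir k' k) : g p * g p = 1 := by
  rcases p with p | p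
  · simp [g]
  · simp only [g]; split_ifs <;> norm_num

theorem g_eq_or (p : Dir k' k) : g p = 1 ∨ g p = -1 := mul_self_eq_one_iff.1 (g_mul_self p)

theorem g_mul_g_of_ne {p q : Dir k' k} (h : g p ≠ g q) : g p * g q = -1 := by
  rcases g_eq_or p with hp | hp <;> rcases g_eq_or q with hq | hq <;> simp_all

/-- Two distinct directions are of commuting units, or of two imaginary units of one algebra. -/
theorem cliffordPair_or_imaginary {p q : Dir k' k} (h : p ≠ q) :
    (CliffordPair (vec p) (vec q) ∧ CliffordPair (tilde (vec p)) (tilde (vec q)) ∧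
      e p * e q = e q * e p) ∨
    (∃ a b : Oct, vec p = (0, a) ∧ vec q = (0, b) ∧ e p = 1 ⊗ₜ[ℝ] a ∧ e q = 1 ⊗ₜ[ℝ] b ∧
      ip 1 a = 0 ∧ ip 1 b = 0 ∧ e p * e q ≠ e q * e p) ∨
    (∃ a b : SplitOct, vec p = (a, 0) ∧ vec q = (b, 0) ∧ e p = a ⊗ₜ[ℝ] 1 ∧ e q = b ⊗ₜ[ℝ] 1 ∧
      ip 1 a = 0 ∧ ip 1 b = 0 ∧ e p * e q ≠ e q * e p) := by
  have key : ∀ {ε : ℝ}, ε * ε = 1 → ∀ {i j : Fin 8}, i ≠ j → i ≠ 0 → j ≠ 0 →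
      ip 1 (unit ε i) = 0 ∧ ip 1 (unit ε j) = 0 ∧
        unit ε i * unit ε j ≠ unit ε j * unit ε i := by
    intro ε hε i j hij hi hj
    have h1 : ∀ {l : Fin 8}, l ≠ 0 → ip 1 (unit ε l) = 0 := by
      intro l hl
      rw [← unit_zero, ip_unit_unit, if_neg hl.symm]
    have h2 : ∀ l : Fin 8, ip (unit ε l) (unit ε l) ≠ 0 := by
      intro l
      have hε0 : ε ≠ 0 := by rintro rfl; norm_num at hε
      rw [ip_unit_unit, if_pos rfl]
      split_ifs
      · exact one_ne_zero
      · exact neg_ne_zero.2 hε0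
    exact ⟨h1 hi, h1 hj, mul_ne_mul (h1 hi) (h1 hj) (by rw [ip_unit_unit, if_neg hij])
      (h2 i) (h2 j)⟩
  rcases p with ⟨i, hi⟩ | ⟨i, hi⟩ <;> rcases q with ⟨j, hj⟩ | ⟨j, hj⟩
  · have hij : i ≠ j := fun hij => h (by subst hij; rfl)
    by_cases hi0 : i = 0
    · subst hi0
      have : ip 1 (unit (-1) j) = 0 := by rw [← unit_zero, ip_unit_unit, if_neg hij]
      have := cliffordPair_one_div this
      refine .inl ⟨?_, ?_, by simp [e, unit_zero]⟩ <;> simpa [vec, tilde, unit_zero] using this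
    by_cases hj0 : j = 0
    · subst hj0
      have : ip 1 (unit (-1) i) = 0 := by rw [← unit_zero, ip_unit_unit, if_neg hij.symm]
      have hp := cliffordPair_one_div this
      have := hp.symm (by simpa [form] using this)
      refine .inl ⟨?_, ?_, by simp [e, unit_zero]⟩ <;> simpa [vec, tilde, unit_zero] using this
    obtain ⟨h1, h2, h3⟩ := key (ε := -1) (by norm_num) hij hi0 hj0
    refine .inr (.inl ⟨_, _, rfl, rfl, rfl, rfl, h1, h2, fun h => h3 (one_tmul_injective ?_)⟩)
    simpa [e] using h
  · refine .inl ⟨cliffordPair_mixed _ _, ?_, by simp [e]⟩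
    simpa [tilde, vec] using cliffordPair_mixed (unit (-1) i) (conj (unit 1 j))
  · refine .inl ⟨(cliffordPair_mixed _ _).symm ?_, ?_, by simp [e]⟩
    · simp [form]
    · have := (cliffordPair_mixed (unit (-1) j) (conj (unit 1 i))).symm (by simp [form])
      simpa [tilde, vec] using this
  · have hij : i ≠ j := fun hij => h (by subst hij; rfl)
    by_cases hi0 : i = 0
    · subst hi0
      have h1 : ip 1 (unit 1 j) = 0 := by rw [← unit_zero, ip_unit_unit, if_neg hij]
      refine .inl ⟨?_, ?_, by simp [e, unit_zero]⟩
      · simpa [vec, unit_zero] using cliffordPair_one_split h1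
      · simpa [vec, unit_zero, tilde] using
          cliffordPair_one_split (A := conj (unit 1 j)) (by rw [← conj_one, ip_conj_conj, h1])
    by_cases hj0 : j = 0
    · subst hj0
      have h1 : ip 1 (unit 1 i) = 0 := by rw [← unit_zero, ip_unit_unit, if_neg hij.symm]
      refine .inl ⟨?_, ?_, by simp [e, unit_zero]⟩
      · simpa [vec, unit_zero] using (cliffordPair_one_split h1).symm (by simpa [form] using h1)
      · have h2 : ip 1 (conj (unit 1 i)) = 0 := by rw [← conj_one, ip_conj_conj, h1]
        simpa [vec, unit_zero, tilde] using
          (cliffordPair_one_split h2).symm (by simpa [form] using h2)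
    obtain ⟨h1, h2, h3⟩ := key (ε := 1) (by norm_num) hij hi0 hj0
    refine .inr (.inr ⟨_, _, rfl, rfl, rfl, rfl, h1, h2, fun h => h3 (tmul_one_injective ?_)⟩)
    simpa [e] using h

end Units

section Exponential

/-! ### The exponential series -/

/-- Linear forms are continuous and separate points. -/
theorem t2Space_moduleTopology (V : Type*) [AddCommGroup V] [Module ℝ V] :
    @T2Space V (moduleTopology ℝ V) := by
  let _ : TopologicalSpace V := moduleTopology ℝ V
  have : IsModuleTopology ℝ V := ⟨rfl⟩
  refine ⟨fun x y hxy => ?_⟩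
  obtain ⟨φ, hφ⟩ : ∃ φ : Module.Dual ℝ V, φ (x - y) ≠ 0 := by
    by_contra! h
    exact hxy (sub_eq_zero.1 ((Module.forall_dual_apply_eq_zero_iff ℝ _).1 h))
  exact separated_by_continuous (IsModuleTopology.continuous_of_linearMap φ)
    (fun h => hφ (by rw [map_sub, h, sub_self]))

section Exp

variable {n : Type} [Fintype n] [DecidableEq n] {B : Matrix n n OO}

/-- If `B² = β`, the even and the odd terms of the exponential series of `t B` are multiples of `1`
and of `B`. -/
theorem mexp_smul_of_hasSum {β t c s : ℝ} (hB : B * B = β • (1 : Matrix n n OO))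
    (hc : HasSum (fun k : ℕ => ((2 * k).factorial : ℝ)⁻¹ * (t ^ (2 * k) * β ^ k)) c)
    (hs : HasSum (fun k : ℕ => ((2 * k + 1).factorial : ℝ)⁻¹ * (t ^ (2 * k + 1) * β ^ k)) s) :
    mexp (t • B) = c • (1 : Matrix n n OO) + s • B := by
  have hpow : ∀ k, mpow (t • B) (2 * k) = (t ^ (2 * k) * β ^ k) • (1 : Matrix n n OO) ∧
      mpow (t • B) (2 * k + 1) = (t ^ (2 * k + 1) * β ^ k) • B := by
    have hodd : ∀ k, mpow (t • B) (2 * k) = (t ^ (2 * k) * β ^ k) • (1 : Matrix n n OO) →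
        mpow (t • B) (2 * k + 1) = (t ^ (2 * k + 1) * β ^ k) • B := by
      intro k h
      rw [mpow, h, mul_smul_comm, mul_one, smul_smul]
      ring_nf
    intro k
    induction k with
    | zero => exact ⟨by simp [mpow], hodd 0 (by simp [mpow])⟩
    | succ k ih =>
      have h : mpow (t • B) (2 * (k + 1)) =
          (t ^ (2 * (k + 1)) * β ^ (k + 1)) • (1 : Matrix n n OO) := by
        rw [show 2 * (k + 1) = (2 * k + 1) + 1 by ring, mpow, ih.2, mul_smul_comm,
          smul_mul_assoc, hB, smul_smul, smul_smul]
        ring_nf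
      exact ⟨h, hodd _ h⟩
  let _ : TopologicalSpace (Matrix n n OO) := moduleTopology ℝ (Matrix n n OO)
  have : IsModuleTopology ℝ (Matrix n n OO) := ⟨rfl⟩
  have : T2Space (Matrix n n OO) := t2Space_moduleTopology _
  have : ContinuousSMul ℝ (Matrix n n OO) := IsModuleTopology.toContinuousSMul ℝ _
  have : ContinuousAdd (Matrix n n OO) := IsModuleTopology.toContinuousAdd ℝ _
  refine HasSum.tsum_eq (HasSum.even_add_odd (m := c • (1 : Matrix n n OO)) (m' := s • B) ?_ ?_)
  · convert hc.smul_const (1 : Matrix n n OO) using 2 with k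
    rw [(hpow k).1, smul_smul]
  · convert hs.smul_const B using 2 with k
    rw [(hpow k).2, smul_smul]

theorem mexp_smul_of_sq_eq_neg_one (t : ℝ) (hB : B * B = -1) :
    mexp (t • B) = Real.cos t • (1 : Matrix n n OO) + Real.sin t • B := by
  refine mexp_smul_of_hasSum (β := -1) (by rw [hB, neg_one_smul]) ?_ ?_
  · convert Real.hasSum_cos t using 2 with k
    ring
  · convert Real.hasSum_sin t using 2 with k
    ring

theorem mexp_smul_of_sq_eq_one (t : ℝ) (hB : B * B = 1) :
    mexp (t • B) = Real.cosh t • (1 : Matrix n n OO) + Real.sinh t • B := by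
  refine mexp_smul_of_hasSum (β := 1) (by rw [hB, one_smul]) ?_ ?_
  · convert Real.hasSum_cosh t using 2 with k
    rw [one_pow]; ring
  · convert Real.hasSum_sinh t using 2 with k
    rw [one_pow]; ring

end Exp

variable {k' k : Label} {p q : Dir k' k}

theorem cFun_neg (t : ℝ) : cFun p q (-t) = cFun p q t := by
  simp [cFun]

theorem sFun_neg (t : ℝ) : sFun p q (-t) = -sFun p q t := by
  simp only [sFun, Real.sin_neg, Real.sinh_neg]; split_ifs <;> rfl

theorem cFun_sq_add (p q : Dir k' k) (t : ℝ) :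
    cFun p q t ^ 2 + g p * g q * sFun p q t ^ 2 = 1 := by
  by_cases h : g p = g q
  · simp [cFun, sFun, h, g_mul_self]
  · simp only [cFun, sFun, h, g_mul_g_of_ne h, if_false]
    linarith [Real.cosh_sq t]

theorem cFun_half (p q : Dir k' k) (θ : ℝ) :
    cFun p q θ = 1 - 2 * (g p * g q) * sFun p q (θ / 2) ^ 2 := by
  by_cases h : g p = g q
  · simp only [cFun, sFun, h, g_mul_self, if_true]
    have := Real.cos_sq (θ / 2)
    rw [mul_div_cancel₀ _ (two_ne_zero' ℝ)] at this
    linarith [Real.sin_sq_add_cos_sq (θ / 2)]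
  · simp only [cFun, sFun, h, g_mul_g_of_ne h, if_false]
    have := Real.cosh_two_mul (θ / 2)
    rw [mul_div_cancel₀ _ (two_ne_zero' ℝ)] at this
    linarith [Real.cosh_sq (θ / 2)]

theorem sFun_half (p q : Dir k' k) (θ : ℝ) :
    sFun p q θ = 2 * sFun p q (θ / 2) * cFun p q (θ / 2) := by
  by_cases h : g p = g q
  · simp only [cFun, sFun, h, if_true]
    rw [← Real.sin_two_mul, mul_div_cancel₀ _ (two_ne_zero' ℝ)]
  · simp only [cFun, sFun, h, if_false]
    rw [← Real.sinh_two_mul, mul_div_cancel₀ _ (two_ne_zero' ℝ)]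

theorem mexp_smul_eq {n : Type} [Fintype n] [DecidableEq n] {B : Matrix n n OO}
    (hB : B * B = -((g p * g q) • (1 : Matrix n n OO))) (t : ℝ) :
    mexp (t • B) = cFun p q t • (1 : Matrix n n OO) + sFun p q t • B := by
  by_cases h : g p = g q
  · rw [h, g_mul_self, one_smul] at hB
    simp only [cFun, sFun, h, if_true, mexp_smul_of_sq_eq_neg_one t hB]
  · rw [g_mul_g_of_ne h, neg_one_smul, neg_neg] at hB
    simp only [cFun, sFun, h, if_false, mexp_smul_of_sq_eq_one t hB]

theorem mexp_neg_smul_eq {n : Type} [Fintype n] [DecidableEq n] {B : Matrix n n OO}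
    (hB : B * B = -((g p * g q) • (1 : Matrix n n OO))) (t : ℝ) :
    mexp (-(t • B)) = cFun p q t • (1 : Matrix n n OO) - sFun p q t • B := by
  rw [← neg_smul, mexp_smul_eq hB, cFun_neg, sFun_neg, neg_smul, sub_eq_add_neg]

/-! ### Coordinates -/

/-- The linear map of `ι → ℝ` with `e_p ↦ c e_p + η_p s e_q`, `e_q ↦ c e_q - η_q s e_p` which
fixes the other basis vectors. -/
def planeRot {ι : Type*} [DecidableEq ι] (η : ι → ℝ) (p q : ι) (c s : ℝ) :
    (ι → ℝ) →ₗ[ℝ] ι → ℝ where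
  toFun v := v + ((c - 1) * v p - η q * s * v q) • Pi.single p 1 +
    ((c - 1) * v q + η p * s * v p) • Pi.single q 1
  map_add' v w := by simp only [Pi.add_apply]; module
  map_smul' r v := by simp only [Pi.smul_apply, smul_eq_mul, RingHom.id_apply]; module

theorem planeRot_apply {ι : Type*} [DecidableEq ι] (η : ι → ℝ) (p q : ι) (c s : ℝ) (v : ι → ℝ) :
    planeRot η p q c s v = v + ((c - 1) * v p - η q * s * v q) • Pi.single p 1 +
      ((c - 1) * v q + η p * s * v p) • Pi.single q 1 := rfl

theorem planeRot_single_fst {ι : Type*} [DecidableEq ι] (η : ι → ℝ) {p q : ι} (h : p ≠ q)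
    (c s : ℝ) : planeRot η p q c s (Pi.single p 1) =
      c • Pi.single p 1 + (η p * s) • Pi.single q 1 := by
  simp only [planeRot_apply, Pi.single_eq_same, Pi.single_eq_of_ne h.symm]; module

theorem planeRot_single_snd {ι : Type*} [DecidableEq ι] (η : ι → ℝ) {p q : ι} (h : p ≠ q)
    (c s : ℝ) : planeRot η p q c s (Pi.single q 1) =
      c • Pi.single q 1 - (η q * s) • Pi.single p 1 := by
  simp only [planeRot_apply, Pi.single_eq_same, Pi.single_eq_of_ne h]; module

theorem planeRot_single_of_ne {ι : Type*} [DecidableEq ι] (η : ι → ℝ) {p q r : ι} (hp : r ≠ p)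
    (hq : r ≠ q) (c s : ℝ) : planeRot η p q c s (Pi.single r 1) = Pi.single r 1 := by
  simp only [planeRot_apply, Pi.single_eq_of_ne hp.symm, Pi.single_eq_of_ne hq.symm]; module

/-- The element of `𝕆' ⊕ 𝕆` with given coordinates in the basis of units of `𝕂'` and `𝕂`. -/
def comb : (Dir k' k → ℝ) →ₗ[ℝ] SplitOct × Oct := Fintype.linearCombination ℝ vec

theorem comb_single (p : Dir k' k) : comb (Pi.single p 1) = vec p := by
  simp [comb]

theorem form_add_right (x y z : SplitOct × Oct) : form x (y + z) = form x y + form x z := by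
  simp [form]; ring

theorem form_smul_right (r : ℝ) (x y : SplitOct × Oct) : form x (r • y) = r * form x y := by
  simp [form]; ring

theorem form_sum_right {α : Type*} (s : Finset α) (f : α → SplitOct × Oct) (x) :
    form x (∑ i ∈ s, f i) = ∑ i ∈ s, form x (f i) := by
  classical
  induction s using Finset.induction_on with
  | empty => simp [form]
  | insert i s hi ih => rw [Finset.sum_insert hi, Finset.sum_insert hi, form_add_right, ih]

theorem form_vec_comb (p : Dir k' k) (v : Dir k' k → ℝ) : form (vec p) (comb v) = g p * v p := by
  rw [comb, Fintype.linearCombination_apply, form_sum_right]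
  simp only [form_smul_right, form_vec_vec, mul_ite, mul_zero]
  rw [Finset.sum_ite_eq Finset.univ p, if_pos (Finset.mem_univ p), mul_comm]

theorem form_comb_comb (v : Dir k' k → ℝ) : form (comb v) (comb v) = ∑ p, g p * v p ^ 2 := by
  conv_lhs => enter [2]; rw [comb, Fintype.linearCombination_apply]
  rw [form_sum_right]
  refine Finset.sum_congr rfl fun p _ => ?_
  rw [form_smul_right, form_comm, form_vec_comb]
  ring

theorem comb_injective : Function.Injective (comb : (Dir k' k → ℝ) → SplitOct × Oct) := by
  intro v w h
  ext p
  have hp := congrArg (form (vec p)) h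
  rw [form_vec_comb, form_vec_comb] at hp
  have : g p ≠ 0 := fun h0 => by simpa [h0] using g_mul_self p
  exact mul_left_cancel₀ this hp

theorem range_comb : LinearMap.range (comb : (Dir k' k → ℝ) →ₗ[ℝ] SplitOct × Oct) =
    k'.split.prod k.div := by
  rw [comb, Fintype.range_linearCombination]
  apply le_antisymm
  · rw [Submodule.span_le]
    rintro _ ⟨p | p, rfl⟩
    · exact ⟨Submodule.zero_mem _, Submodule.subset_span ⟨p.1, p.2, rfl⟩⟩
    · exact ⟨Submodule.subset_span ⟨p.1, p.2, rfl⟩, Submodule.zero_mem _⟩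
  · have h1 : k'.split ≤ (Submodule.span ℝ (Set.range (vec : Dir k' k → _))).comap
        (LinearMap.inl ℝ SplitOct Oct) := by
      rw [Label.split, Submodule.span_le]
      rintro _ ⟨i, hi, rfl⟩
      exact Submodule.subset_span ⟨.inr ⟨i, hi⟩, rfl⟩
    have h2 : k.div ≤ (Submodule.span ℝ (Set.range (vec : Dir k' k → _))).comap
        (LinearMap.inr ℝ SplitOct Oct) := by
      rw [Label.div, Submodule.span_le]
      rintro _ ⟨i, hi, rfl⟩
      exact Submodule.subset_span ⟨.inl ⟨i, hi⟩, rfl⟩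
    rintro ⟨A, a⟩ h
    obtain ⟨hA, ha⟩ := Submodule.mem_prod.1 h
    have hA' := Submodule.mem_comap.1 (h1 hA)
    have ha' := Submodule.mem_comap.1 (h2 ha)
    simpa using add_mem hA' ha'

theorem mem_V2_iff {X : Mat2} : X ∈ V2 k' k ↔ ∃ v : Dir k' k → ℝ, X = vecMat (comb v) := by
  rw [V2, ← range_comb, ← LinearMap.range_comp]
  exact ⟨fun ⟨v, h⟩ => ⟨v, h.symm⟩, fun ⟨v, h⟩ => ⟨v, h.symm⟩⟩

theorem mem_V4_iff {P : Mat4} : P ∈ V4 k' k ↔ ∃ v : Dir k' k → ℝ, P = Gam (vecMat (comb v)) := by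
  constructor
  · rintro ⟨X, hX, rfl⟩
    obtain ⟨v, rfl⟩ := mem_V2_iff.1 hX
    exact ⟨v, rfl⟩
  · rintro ⟨v, rfl⟩
    exact ⟨_, mem_V2_iff.2 ⟨v, rfl⟩, rfl⟩

/-! ### The exponential action -/

theorem spinRot_comb (θ : ℝ) (v : Dir k' k → ℝ) :
    spinRot (vec p) (vec q) (cFun p q (θ / 2)) (sFun p q (θ / 2)) (comb v) =
      comb (planeRot g p q (cFun p q θ) (sFun p q θ) v) := by
  simp only [spinRot, planeRot_apply, map_add, map_smul, comb_single, form_vec_comb,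
    form_vec_self]
  rw [cFun_half p q θ, sFun_half p q θ]
  match_scalars <;> ring

section

variable (h : CliffordPair (vec p) (vec q)) (h' : CliffordPair (tilde (vec p)) (tilde (vec q)))
include h h'

theorem gam_mul_gam_sq : (gam p * gam q) * (gam p * gam q) = -((g p * g q) • (1 : Mat4)) := by
  rw [gam_eq, gam_eq, h.Gam_sq h', form_vec_self, form_vec_self]

theorem expM_eq (θ : ℝ) :
    expM p q θ = cFun p q (θ / 2) • (1 : Mat4) - sFun p q (θ / 2) • (gam p * gam q) :=
  mexp_neg_smul_eq (gam_mul_gam_sq h h') _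

theorem expMInv_eq (θ : ℝ) :
    expMInv p q θ = cFun p q (θ / 2) • (1 : Mat4) + sFun p q (θ / 2) • (gam p * gam q) :=
  mexp_smul_eq (gam_mul_gam_sq h h') _

theorem expM_mul_expMInv (θ : ℝ) : expM p q θ * expMInv p q θ = 1 := by
  rw [expM_eq h h', expMInv_eq h h']
  exact sub_smul_mul_add_smul (gam_mul_gam_sq h h') (cFun_sq_add p q _)

theorem expMInv_mul_expM (θ : ℝ) : expMInv p q θ * expM p q θ = 1 := by
  rw [expM_eq h h', expMInv_eq h h']
  exact add_smul_mul_sub_smul (gam_mul_gam_sq h h') (cFun_sq_add p q _)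

theorem expM_mul_assoc (θ : ℝ) (z : SplitOct × Oct) :
    (expM p q θ * Gam (vecMat z)) * expMInv p q θ =
      expM p q θ * (Gam (vecMat z) * expMInv p q θ) := by
  rw [expM_eq h h', expMInv_eq h h', gam_eq, gam_eq]
  exact sub_smul_mul_mul_add_smul_assoc (h.Gam_assoc h' z)

theorem expMap4_eq_spinRot (θ : ℝ) (z : SplitOct × Oct) :
    expMap4 p q θ (Gam (vecMat z)) =
      Gam (vecMat (spinRot (vec p) (vec q) (cFun p q (θ / 2)) (sFun p q (θ / 2)) z)) := by
  rw [expMap4, expM_eq h h', expMInv_eq h h', gam_eq, gam_eq]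
  refine h.conj_Gam h' ?_ z
  rw [form_vec_self, form_vec_self, cFun_sq_add]

theorem expMap2_eq_spinRot (θ : ℝ) (z : SplitOct × Oct) :
    expMap2 p q θ (vecMat z) =
      vecMat (spinRot (vec p) (vec q) (cFun p q (θ / 2)) (sFun p q (θ / 2)) z) := by
  have hU := h.sq
  have hL := h'.sq
  simp only [tilde_tilde, form_tilde, form_vec_self] at hU hL
  have h4 := expMap4_eq_spinRot h h' θ z
  rw [expMap4, expM_eq h h', expMInv_eq h h', gam_eq, gam_eq, Gam_mul_Gam, Gam_vecMat, Gam_vecMat,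
    ← Matrix.fromBlocks_one, sub_eq_add_neg] at h4
  simp only [Matrix.fromBlocks_smul, Matrix.fromBlocks_neg, Matrix.fromBlocks_add,
    Matrix.fromBlocks_multiply] at h4
  have h2 := (Matrix.fromBlocks_inj.1 h4).2.1
  rw [expMap2, pauli_eq, pauli_eq, map_conjSplit_vecMat, map_conjSplit_vecMat,
    mexp_neg_smul_eq hU, mexp_smul_eq hL, ← h2]
  simp [sub_eq_add_neg]

theorem expMap4_comb (θ : ℝ) (v : Dir k' k → ℝ) :
    expMap4 p q θ (Gam (vecMat (comb v))) =
      Gam (vecMat (comb (planeRot g p q (cFun p q θ) (sFun p q θ) v))) := by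
  rw [expMap4_eq_spinRot h h', spinRot_comb]

theorem expMap2_comb (θ : ℝ) (v : Dir k' k → ℝ) :
    expMap2 p q θ (vecMat (comb v)) =
      vecMat (comb (planeRot g p q (cFun p q θ) (sFun p q θ) v)) := by
  rw [expMap2_eq_spinRot h h', spinRot_comb]

end

end Exponential

section Flips

/-! ### Flips -/

namespace CayleyDickson

variable {ε : ℝ}

theorem ip_mul_mul (x y : CayleyDickson ε) : ip (x * y) (x * y) = ip x x * ip y y := by
  simp [ip]; ring

theorem conj_of_ip_one {x : CayleyDickson ε} (hx : ip 1 x = 0) : conj x = -x := by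
  rw [conj_eq, hx]; simp

theorem ip_conj_right {u : CayleyDickson ε} (hu : ip 1 u = 0) (x : CayleyDickson ε) :
    ip u (conj x) = -ip u x := by
  rw [← ip_conj_conj, conj_of_ip_one hu, conj_conj, ip_neg_left]

theorem mul_mul_conj_of_ip_one {u : CayleyDickson ε} (hu : ip 1 u = 0) (x : CayleyDickson ε) :
    (u * x) * conj u = ip u u • conj x + (2 * ip u x) • u := by
  have h : u * x = conj x * u - (2 * ip u x) • 1 := by
    rw [← conj_mul_add, conj_of_ip_one hu]; simp
  rw [h, sub_mul, mul_mul_conj, conj_of_ip_one hu]; simp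

theorem mul_mul_conj_of_ip_one' {u : CayleyDickson ε} (hu : ip 1 u = 0) (x : CayleyDickson ε) :
    u * (x * conj u) = ip u u • conj x + (2 * ip u x) • u := by
  have h : x * conj u = (2 * ip u x) • 1 - u * conj x := by
    rw [← mul_conj_add]; simp
  have h2 := conj_mul_mul u (conj x)
  rw [conj_of_ip_one hu, neg_mul] at h2
  rw [h, mul_sub, ← h2, mul_smul_comm, mul_one]; abel

/-- The square of the product of two orthogonal imaginary elements. -/
theorem mul_mul_mul_self {x y : CayleyDickson ε} (hx : ip 1 x = 0) (hy : ip 1 y = 0)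
    (hxy : ip x y = 0) : (x * y) * (x * y) = -((ip x x * ip y y) • 1) := by
  have h : conj (x * y) = -(x * y) := by
    rw [conj_mul, conj_of_ip_one hx, conj_of_ip_one hy, neg_mul_neg, mul_eq_neg_mul hx hy hxy,
      neg_neg]
  rw [← ip_mul_mul, ← mul_conj_self, h, mul_neg, neg_neg]

/-- For an imaginary `u` of nonzero norm this is `x ↦ u x u⁻¹` (`smul_mul_mul_conj`), in closed
form. -/
def conjBy (u x : CayleyDickson ε) : CayleyDickson ε := conj x + ((ip u u)⁻¹ * (2 * ip u x)) • u

theorem conj_conjBy {u : CayleyDickson ε} (hu : ip 1 u = 0) (x : CayleyDickson ε) :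
    conj (conjBy u x) = conjBy u (conj x) := by
  rw [conjBy, conjBy, map_add, map_smul, conj_of_ip_one hu, ip_conj_right hu]
  module

theorem smul_mul_mul_conj {u : CayleyDickson ε} (hu : ip 1 u = 0) (h0 : ip u u ≠ 0)
    (x : CayleyDickson ε) : (ip u u)⁻¹ • ((u * x) * conj u) = conjBy u x := by
  rw [mul_mul_conj_of_ip_one hu, smul_add, smul_smul, inv_mul_cancel₀ h0, one_smul, smul_smul,
    conjBy]

theorem smul_mul_mul_conj' {u : CayleyDickson ε} (hu : ip 1 u = 0) (h0 : ip u u ≠ 0)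
    (x : CayleyDickson ε) : (ip u u)⁻¹ • (u * (x * conj u)) = conjBy u x := by
  rw [mul_mul_conj_of_ip_one' hu, smul_add, smul_smul, inv_mul_cancel₀ h0, one_smul, smul_smul,
    conjBy]

theorem conjBy_neg (u x : CayleyDickson ε) : conjBy (-u) x = conjBy u x := by
  simp [conjBy]

/-- The composite of the flips in `a` and in the unit vector `c a + s b` of the plane of two
orthogonal imaginary elements is a rotation of this plane. -/
theorem conjBy_conjBy {a b : CayleyDickson ε} (ha : ip 1 a = 0) (hb : ip 1 b = 0) (hab : ip a b = 0)
    (h0 : ip a a ≠ 0) {c s : ℝ} (hu : ip (c • a + s • b) (c • a + s • b) = ip a a)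
    (x : CayleyDickson ε) :
    conjBy (c • a + s • b) (conjBy a x) = x - (2 * (ip a a)⁻¹ * ip a x) • a +
      (2 * (ip a a)⁻¹ * (c * ip a x - s * ip b x)) • (c • a + s • b) := by
  have hba : ip b a = 0 := by rw [ip_comm, hab]
  rw [conjBy, hu, conj_conjBy ha, conjBy, conjBy, conj_conj]
  simp only [ip_add_left, ip_smul_left, ip_add_right, ip_smul_right, ip_conj_right ha,
    ip_conj_right hb, hba]
  match_scalars <;> field_simp <;> ring

end CayleyDickson

theorem scalarMat_mul {n : Type} [Fintype n] [DecidableEq n] (u : OO) (P : Matrix n n OO) :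
    scalarMat u * P = Matrix.of fun i j => u * P i j := by
  ext i j; simp [scalarMat]

theorem mul_scalarMat {n : Type} [Fintype n] [DecidableEq n] (u : OO) (P : Matrix n n OO) :
    P * scalarMat u = Matrix.of fun i j => P i j * u := by
  ext i j; simp [scalarMat]

theorem scalarMat_mul_scalarMat {n : Type} [Fintype n] [DecidableEq n] {u w : OO}
    (h : u * w = 1) : (scalarMat u * scalarMat w : Matrix n n OO) = 1 := by
  rw [scalarMat, scalarMat, Matrix.diagonal_mul_diagonal, ← Matrix.diagonal_one]
  simp only [h]

theorem scalarMat_eq_fromBlocks (u : OO) :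
    (scalarMat u : Mat4) = Matrix.fromBlocks (scalarMat u) 0 0 (scalarMat u) := by
  rw [scalarMat, scalarMat, Matrix.fromBlocks_diagonal]
  congr 1
  ext (i | i) <;> rfl

/-- The scalar `u` has the inverse `w`, and `X ↦ u X w`, with either bracketing, acts on the
matrices `vecMat z` through the map `φ`. -/
structure ActsBy (u w : OO) (φ : SplitOct × Oct → SplitOct × Oct) : Prop where
  mul_inv : u * w = 1
  inv_mul : w * u = 1
  vecMat (z) : (scalarMat u * vecMat z) * scalarMat w = vecMat (φ z)
  vecMat' (z) : scalarMat u * (MagicSquare.vecMat z * scalarMat w) = MagicSquare.vecMat (φ z)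
  tilde (z) : tilde (φ z) = φ (tilde z)

namespace ActsBy

variable {u w : OO} {φ : SplitOct × Oct → SplitOct × Oct} (h : ActsBy u w φ)
include h

theorem Gam_vecMat (z : SplitOct × Oct) :
    (scalarMat u * Gam (MagicSquare.vecMat z)) * scalarMat w = Gam (MagicSquare.vecMat (φ z)) := by
  rw [scalarMat_eq_fromBlocks, scalarMat_eq_fromBlocks w, MagicSquare.Gam_vecMat,
    MagicSquare.Gam_vecMat, h.tilde, ← h.vecMat, ← h.vecMat]
  simp [Matrix.fromBlocks_multiply]

theorem Gam_vecMat' (z : SplitOct × Oct) :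
    scalarMat u * (Gam (MagicSquare.vecMat z) * scalarMat w) = Gam (MagicSquare.vecMat (φ z)) := by
  rw [scalarMat_eq_fromBlocks, scalarMat_eq_fromBlocks w, MagicSquare.Gam_vecMat,
    MagicSquare.Gam_vecMat, h.tilde, ← h.vecMat', ← h.vecMat']
  simp [Matrix.fromBlocks_multiply]

end ActsBy

theorem actsBy_div {u : Oct} (hu : ip 1 u = 0) (h0 : ip u u ≠ 0) :
    ActsBy (1 ⊗ₜ[ℝ] u) ((ip u u)⁻¹ • (1 ⊗ₜ[ℝ] conj u)) fun z => (z.1, conjBy u z.2) := by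
  have h1 : (ip u u)⁻¹ • (u * conj u) = 1 := by
    rw [mul_conj_self, smul_smul, inv_mul_cancel₀ h0, one_smul]
  have h2 : (ip u u)⁻¹ • (conj u * u) = 1 := by
    rw [conj_mul_self, smul_smul, inv_mul_cancel₀ h0, one_smul]
  constructor
  · rw [← TensorProduct.tmul_smul, Algebra.TensorProduct.tmul_mul_tmul, mul_smul_comm, h1, one_mul,
      Algebra.TensorProduct.one_def]
  · rw [← TensorProduct.tmul_smul, Algebra.TensorProduct.tmul_mul_tmul, smul_mul_assoc, h2, one_mul,
      Algebra.TensorProduct.one_def]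
  · intro z
    rw [scalarMat_mul, mul_scalarMat]
    ext i j
    fin_cases i <;> fin_cases j <;>
      simp [vecMat_apply, mul_smul_comm, ← TensorProduct.tmul_smul, h1, smul_mul_mul_conj hu h0,
        conj_conjBy hu]
  · intro z
    rw [mul_scalarMat, scalarMat_mul]
    ext i j
    fin_cases i <;> fin_cases j <;>
      simp [vecMat_apply, mul_smul_comm, ← TensorProduct.tmul_smul, h1, smul_mul_mul_conj' hu h0,
        conj_conjBy hu]
  · intro z; rfl

theorem actsBy_split {u : SplitOct} (hu : ip 1 u = 0) (h0 : ip u u ≠ 0) :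
    ActsBy (u ⊗ₜ[ℝ] 1) ((ip u u)⁻¹ • (conj u ⊗ₜ[ℝ] 1)) fun z => (conjBy u z.1, z.2) := by
  have h1 : (ip u u)⁻¹ • (u * conj u) = 1 := by
    rw [mul_conj_self, smul_smul, inv_mul_cancel₀ h0, one_smul]
  have h2 : (ip u u)⁻¹ • (conj u * u) = 1 := by
    rw [conj_mul_self, smul_smul, inv_mul_cancel₀ h0, one_smul]
  constructor
  · rw [TensorProduct.smul_tmul', Algebra.TensorProduct.tmul_mul_tmul, mul_smul_comm, h1, one_mul,
      Algebra.TensorProduct.one_def]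
  · rw [TensorProduct.smul_tmul', Algebra.TensorProduct.tmul_mul_tmul, smul_mul_assoc, h2, one_mul,
      Algebra.TensorProduct.one_def]
  · intro z
    rw [scalarMat_mul, mul_scalarMat]
    ext i j
    fin_cases i <;> fin_cases j <;>
      simp [vecMat_apply, mul_smul_comm, TensorProduct.smul_tmul', h1, smul_mul_mul_conj hu h0,
        conj_conjBy hu]
  · intro z
    rw [mul_scalarMat, scalarMat_mul]
    ext i j
    fin_cases i <;> fin_cases j <;>
      simp [vecMat_apply, mul_smul_comm, TensorProduct.smul_tmul', h1, smul_mul_mul_conj' hu h0,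
        conj_conjBy hu]
  · intro z
    simp [tilde, conj_conjBy hu]

variable {k' k : Label} {p q : Dir k' k}

theorem OO_one_ne_zero : (1 : OO) ≠ 0 := by
  intro h
  have : (1 : SplitOct) ⊗ₜ[ℝ] (1 : Oct) = 1 ⊗ₜ[ℝ] 0 := by
    rw [TensorProduct.tmul_zero, ← h, Algebra.TensorProduct.one_def]
  have h1 := congrArg (ip 1) (one_tmul_injective this)
  simp at h1

theorem flipUnit_eq (h : (e p * e q) * (e p * e q) = -((g p * g q) • 1)) (θ : ℝ) :
    flipUnit p q θ = cFun p q (θ / 2) • e p + sFun p q (θ / 2) • e q := by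
  by_cases hg : g p = g q
  · rw [hg, g_mul_self, one_smul] at h
    have h1 : (-1 : OO) ≠ 1 := by
      intro h1
      have h2 : (2 : ℝ) • (1 : OO) = 0 := by
        rw [two_smul]; nth_rewrite 1 [← h1]; exact neg_add_cancel 1
      exact OO_one_ne_zero ((smul_eq_zero.1 h2).resolve_left two_ne_zero)
    simp only [flipUnit, cFun, sFun, hg, h, h1, if_true, if_false]
  · rw [g_mul_g_of_ne hg, neg_one_smul, neg_neg] at h
    simp only [flipUnit, cFun, sFun, hg, h, if_true, if_false]

theorem conjBy_mem_div {u x : Oct} (hu : u ∈ k.div) (hx : x ∈ k.div) : conjBy u x ∈ k.div := by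
  have h1 : (1 : Oct) ∈ k.div := by
    rw [← unit_zero]
    exact Submodule.subset_span ⟨0, by cases k <;> simp [Label.divIdx], rfl⟩
  rw [conjBy, conj_eq]
  exact add_mem (sub_mem (Submodule.smul_mem _ _ h1) hx) (Submodule.smul_mem _ _ hu)

theorem conjBy_mem_split {u x : SplitOct} (hu : u ∈ k'.split) (hx : x ∈ k'.split) :
    conjBy u x ∈ k'.split := by
  have h1 : (1 : SplitOct) ∈ k'.split := by
    rw [← unit_zero]
    exact Submodule.subset_span ⟨0, by cases k' <;> simp [Label.splitIdx], rfl⟩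
  rw [conjBy, conj_eq]
  exact add_mem (sub_mem (Submodule.smul_mem _ _ h1) hx) (Submodule.smul_mem _ _ hu)

theorem vec_mem (p : Dir k' k) : vec p ∈ k'.split.prod k.div := by
  rw [← range_comb, ← comb_single]
  exact ⟨_, rfl⟩

theorem add_smul_vec_eq_comb_planeRot (θ : ℝ) (v : Dir k' k → ℝ) :
    comb v - (2 * g p * (g p * v p)) • vec p +
      (2 * g p * (cFun p q (θ / 2) * (g p * v p) - sFun p q (θ / 2) * (g q * v q))) •
        (cFun p q (θ / 2) • vec p + sFun p q (θ / 2) • vec q) =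
      comb (planeRot g p q (cFun p q θ) (g p * sFun p q θ) v) := by
  have h := cFun_sq_add p q (θ / 2)
  have hp := g_mul_self p
  rw [planeRot_apply, map_add, map_add, map_smul, map_smul, comb_single, comb_single,
    cFun_half p q θ, sFun_half p q θ]
  match_scalars
  · ring
  · linear_combination (2 * v p * g p ^ 2) * h - 2 * v p * g p * g q * sFun p q (θ / 2) ^ 2 * hp
  · ring

theorem ip_add_smul_self {ε : ℝ} {a b : CayleyDickson ε} (haa : ip a a = g p) (hbb : ip b b = g q)
    (hab : ip a b = 0) (t : ℝ) :
    ip (cFun p q t • a + sFun p q t • b) (cFun p q t • a + sFun p q t • b) = ip a a := by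
  have h := cFun_sq_add p q t
  simp only [ip_add_left, ip_add_right, ip_smul_left, ip_smul_right, hab, ip_comm b a, haa, hbb]
  linear_combination g p * h - g q * sFun p q t ^ 2 * g_mul_self p

/-- In the anticommuting case both factors of the nested conjBy act on `V₂`, and together they
rotate the `pq`-plane. -/
theorem exists_actsBy (hpq : e p * e q ≠ e q * e p) (θ : ℝ) :
    e p * e q = -(e q * e p) ∧ ∃ φ₁ φ₂ : SplitOct × Oct → SplitOct × Oct,
      ActsBy (-e p) ((g p)⁻¹ • conjBoth (-e p)) φ₁ ∧
      ActsBy (flipUnit p q θ) ((g p)⁻¹ • conjBoth (flipUnit p q θ)) φ₂ ∧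
      (∀ v : Dir k' k → ℝ, φ₁ (comb v) ∈ k'.split.prod k.div) ∧
      ∀ v, φ₂ (φ₁ (comb v)) = comb (planeRot g p q (cFun p q θ) (g p * sFun p q θ) v) := by
  have hne : p ≠ q := by rintro rfl; exact hpq rfl
  have hg0 : g p ≠ 0 := fun h0 => by simpa [h0] using g_mul_self p
  have hginv : (g p)⁻¹ = g p := inv_eq_of_mul_eq_one_left (g_mul_self p)
  have hpp := form_vec_self p
  have hqq := form_vec_self q
  have hpq' := form_vec_of_ne hne
  have hmem : ∀ v : Dir k' k → ℝ, comb v ∈ k'.split.prod k.div := fun v => by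
    rw [← range_comb]; exact ⟨v, rfl⟩
  have hp := vec_mem p
  rcases cliffordPair_or_imaginary hne with ⟨-, -, h⟩ | ⟨a, b, hva, hvb, hea, heb, ha, hb, -⟩ |
    ⟨a, b, hva, hvb, hea, heb, ha, hb, -⟩
  · exact absurd h hpq
  · have haa : ip a a = g p := by simpa [hva, form] using hpp
    have hbb : ip b b = g q := by simpa [hvb, form] using hqq
    have hab : ip a b = 0 := by simpa [hva, hvb, form] using hpq'
    have hu1 : ip 1 (cFun p q (θ / 2) • a + sFun p q (θ / 2) • b) = 0 := by simp [ha, hb]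
    have huu := ip_add_smul_self haa hbb hab (θ / 2)
    have hsq : (e p * e q) * (e p * e q) = -((g p * g q) • 1) := by
      simp [hea, heb, mul_mul_mul_self ha hb hab, haa, hbb, TensorProduct.tmul_neg,
        Algebra.TensorProduct.one_def]
    have hfu : flipUnit p q θ = 1 ⊗ₜ[ℝ] (cFun p q (θ / 2) • a + sFun p q (θ / 2) • b) := by
      rw [flipUnit_eq hsq, hea, heb, TensorProduct.tmul_add, TensorProduct.tmul_smul,
        TensorProduct.tmul_smul]
    refine ⟨by simp [hea, heb, mul_eq_neg_mul ha hb hab, TensorProduct.tmul_neg],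
      fun z => (z.1, conjBy a z.2),
      fun z => (z.1, conjBy (cFun p q (θ / 2) • a + sFun p q (θ / 2) • b) z.2), ?_, ?_, ?_, ?_⟩
    · have := actsBy_div (u := -a) (by simp [ha]) (by simp [haa, hg0])
      simp only [conjBy_neg, ip_neg_left, ip_neg_right, neg_neg, haa] at this
      simpa [hea, conjBoth, TensorProduct.tmul_neg] using this
    · have := actsBy_div hu1 (by rw [huu, haa]; exact hg0)
      rw [hfu]
      simpa only [huu, haa, conjBoth, TensorProduct.map_tmul, conj_one] using this
    · intro v
      obtain ⟨h1, h2⟩ := Submodule.mem_prod.1 (hmem v)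
      rw [hva] at hp
      exact Submodule.mem_prod.2 ⟨h1, conjBy_mem_div (Submodule.mem_prod.1 hp).2 h2⟩
    · intro v
      have h1 : ip a (comb v).2 = g p * v p := by simpa [hva, form] using form_vec_comb p v
      have h2 : ip b (comb v).2 = g q * v q := by simpa [hvb, form] using form_vec_comb q v
      rw [← add_smul_vec_eq_comb_planeRot]
      dsimp only
      rw [conjBy_conjBy ha hb hab (by rw [haa]; exact hg0) huu, h1, h2,
        haa, hginv, hva, hvb]
      ext <;> simp
  · have haa : ip a a = g p := by simpa [hva, form] using hpp
    have hbb : ip b b = g q := by simpa [hvb, form] using hqq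
    have hab : ip a b = 0 := by simpa [hva, hvb, form] using hpq'
    have hu1 : ip 1 (cFun p q (θ / 2) • a + sFun p q (θ / 2) • b) = 0 := by simp [ha, hb]
    have huu := ip_add_smul_self haa hbb hab (θ / 2)
    have hsq : (e p * e q) * (e p * e q) = -((g p * g q) • 1) := by
      simp [hea, heb, mul_mul_mul_self ha hb hab, haa, hbb, TensorProduct.neg_tmul,
        Algebra.TensorProduct.one_def, TensorProduct.smul_tmul']
    have hfu : flipUnit p q θ = (cFun p q (θ / 2) • a + sFun p q (θ / 2) • b) ⊗ₜ[ℝ] 1 := by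
      rw [flipUnit_eq hsq, hea, heb, TensorProduct.add_tmul, TensorProduct.smul_tmul',
        TensorProduct.smul_tmul']
    refine ⟨by simp [hea, heb, mul_eq_neg_mul ha hb hab, TensorProduct.neg_tmul],
      fun z => (conjBy a z.1, z.2),
      fun z => (conjBy (cFun p q (θ / 2) • a + sFun p q (θ / 2) • b) z.1, z.2), ?_, ?_, ?_, ?_⟩
    · have := actsBy_split (u := -a) (by simp [ha]) (by simp [haa, hg0])
      simp only [conjBy_neg, ip_neg_left, ip_neg_right, neg_neg, haa] at this
      simpa [hea, conjBoth, TensorProduct.neg_tmul] using this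
    · have := actsBy_split hu1 (by rw [huu, haa]; exact hg0)
      rw [hfu]
      simpa only [huu, haa, conjBoth, TensorProduct.map_tmul, conj_one] using this
    · intro v
      obtain ⟨h1, h2⟩ := Submodule.mem_prod.1 (hmem v)
      rw [hva] at hp
      exact Submodule.mem_prod.2 ⟨conjBy_mem_split (Submodule.mem_prod.1 hp).1 h1, h2⟩
    · intro v
      have h1 : ip a (comb v).1 = g p * v p := by simpa [hva, form] using form_vec_comb p v
      have h2 : ip b (comb v).1 = g q * v q := by simpa [hvb, form] using form_vec_comb q v
      rw [← add_smul_vec_eq_comb_planeRot]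
      dsimp only
      rw [conjBy_conjBy ha hb hab (by rw [haa]; exact hg0) huu, h1, h2,
        haa, hginv, hva, hvb]
      ext <;> simp

/-! ### The two kinds of maps in coordinates -/

open scoped Classical in
/-- The sign by which the angle is multiplied in the plane rotation attached to `(p, q)`: in the
convention of `planeRot` the nested flip turns by `g_pp θ`. -/
def orient (p q : Dir k' k) : ℝ := if e p * e q = e q * e p then 1 else g p

theorem nestedFlip4_comb (hpq : e p * e q ≠ e q * e p) (θ : ℝ) (v : Dir k' k → ℝ) :
    nestedFlip p q θ (Gam (vecMat (comb v))) =
      Gam (vecMat (comb (planeRot g p q (cFun p q θ) (g p * sFun p q θ) v))) := by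
  obtain ⟨-, φ₁, φ₂, h1, h2, -, h⟩ := exists_actsBy hpq θ
  rw [nestedFlip, flipM1, flipM1Inv, flipM2, flipM2Inv, h1.Gam_vecMat, h2.Gam_vecMat, h]

theorem nestedFlip2_comb (hpq : e p * e q ≠ e q * e p) (θ : ℝ) (v : Dir k' k → ℝ) :
    nestedFlip p q θ (vecMat (comb v)) =
      vecMat (comb (planeRot g p q (cFun p q θ) (g p * sFun p q θ) v)) := by
  obtain ⟨-, φ₁, φ₂, h1, h2, -, h⟩ := exists_actsBy hpq θ
  rw [nestedFlip, flipM1, flipM1Inv, flipM2, flipM2Inv, h1.vecMat, h2.vecMat, h]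

theorem cliffordPair_of_comm (hpq : p ≠ q) (h : e p * e q = e q * e p) :
    CliffordPair (vec p) (vec q) ∧ CliffordPair (tilde (vec p)) (tilde (vec q)) := by
  rcases cliffordPair_or_imaginary hpq with h' | ⟨_, _, _, _, _, _, _, _, h'⟩ |
    ⟨_, _, _, _, _, _, _, _, h'⟩
  exacts [⟨h'.1, h'.2.1⟩, absurd h h', absurd h h']

theorem planeMap4_comb (hpq : p ≠ q) (θ : ℝ) (v : Dir k' k → ℝ) :
    planeMap4 p q θ (Gam (vecMat (comb v))) =
      Gam (vecMat (comb (planeRot g p q (cFun p q θ) (orient p q * sFun p q θ) v))) := by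
  by_cases h : e p * e q = e q * e p
  · obtain ⟨h1, h2⟩ := cliffordPair_of_comm hpq h
    rw [planeMap4, orient, if_pos h, if_pos h, one_mul, expMap4_comb h1 h2]
  · rw [planeMap4, orient, if_neg h, if_neg h, nestedFlip4_comb h]

theorem planeMap2_comb (hpq : p ≠ q) (θ : ℝ) (v : Dir k' k → ℝ) :
    planeMap2 p q θ (vecMat (comb v)) =
      vecMat (comb (planeRot g p q (cFun p q θ) (orient p q * sFun p q θ) v)) := by
  by_cases h : e p * e q = e q * e p
  · obtain ⟨h1, h2⟩ := cliffordPair_of_comm hpq h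
    rw [planeMap2, orient, if_pos h, if_pos h, one_mul, expMap2_comb h1 h2]
  · rw [planeMap2, orient, if_neg h, if_neg h, nestedFlip2_comb h]

end Flips

section PlaneGroup

/-! ### Plane rotations and boosts -/

section PlaneRot

variable {ι : Type*} [DecidableEq ι] {η : ι → ℝ} {p q : ι}

theorem planeRot_apply_fst (h : p ≠ q) (c s : ℝ) (v : ι → ℝ) :
    planeRot η p q c s v p = c * v p - η q * s * v q := by
  simp [planeRot_apply, h]; ring

theorem planeRot_apply_snd (h : p ≠ q) (c s : ℝ) (v : ι → ℝ) :
    planeRot η p q c s v q = c * v q + η p * s * v p := by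
  simp [planeRot_apply, h.symm]; ring

theorem planeRot_apply_of_ne {r : ι} (hp : r ≠ p) (hq : r ≠ q) (c s : ℝ) (v : ι → ℝ) :
    planeRot η p q c s v r = v r := by
  simp [planeRot_apply, hp, hq]

theorem planeRot_planeRot (h : p ≠ q) (c s c' s' : ℝ) (v : ι → ℝ) :
    planeRot η p q c s (planeRot η p q c' s' v) =
      planeRot η p q (c * c' - η p * η q * (s * s')) (s * c' + c * s') v := by
  ext r
  by_cases hp : r = p
  · subst hp; simp only [planeRot_apply_fst h, planeRot_apply_snd h]; ring
  by_cases hq : r = q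
  · subst hq; simp only [planeRot_apply_fst h, planeRot_apply_snd h]; ring
  simp only [planeRot_apply_of_ne hp hq]

theorem planeRot_one_zero (v : ι → ℝ) : planeRot η p q 1 0 v = v := by
  simp [planeRot_apply]

variable [Fintype ι]

theorem sum_mul_sq_add_single (x : ι → ℝ) (a : ℝ) (p : ι) :
    ∑ i, η i * (x + a • (Pi.single p 1 : ι → ℝ)) i ^ 2 =
      ∑ i, η i * x i ^ 2 + η p * (2 * a * x p + a ^ 2) := by
  have : ∀ i, η i * (x + a • (Pi.single p 1 : ι → ℝ)) i ^ 2 =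
      η i * x i ^ 2 + if i = p then η p * (2 * a * x p + a ^ 2) else 0 := by
    intro i
    by_cases h : i = p
    · subst h; simp; ring
    · simp [h]
  rw [Finset.sum_congr rfl fun i _ => this i, Finset.sum_add_distrib,
    Finset.sum_ite_eq' Finset.univ, if_pos (Finset.mem_univ p)]

theorem sum_mul_planeRot_sq (h : p ≠ q) {c s : ℝ} (hcs : c ^ 2 + η p * η q * s ^ 2 = 1)
    (v : ι → ℝ) :
    ∑ i, η i * planeRot η p q c s v i ^ 2 = ∑ i, η i * v i ^ 2 := by
  rw [planeRot_apply, sum_mul_sq_add_single, sum_mul_sq_add_single]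
  simp only [Pi.add_apply, Pi.smul_apply, Pi.single_eq_of_ne h.symm, smul_eq_mul, mul_zero,
    add_zero]
  linear_combination (η p * v p ^ 2 + η q * v q ^ 2) * hcs

/-- The matrix of a plane rotation is `1 + A B` with `A` of two columns, so that its determinant
is the `2 × 2` determinant of `1 + B A`. -/
theorem det_toMatrix'_planeRot (h : p ≠ q) {c s : ℝ} (hcs : c ^ 2 + η p * η q * s ^ 2 = 1) :
    (LinearMap.toMatrix' (planeRot η p q c s)).det = 1 := by
  let A : Matrix ι (Fin 2) ℝ := Matrix.of fun i j =>
    ![(Pi.single p 1 : ι → ℝ) i, (Pi.single q 1 : ι → ℝ) i] j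
  let B : Matrix (Fin 2) ι ℝ := Matrix.of fun i j =>
    ![(c - 1) * (Pi.single p 1 : ι → ℝ) j - η q * s * (Pi.single q 1 : ι → ℝ) j,
      (c - 1) * (Pi.single q 1 : ι → ℝ) j + η p * s * (Pi.single p 1 : ι → ℝ) j] i
  have hAB : LinearMap.toMatrix' (planeRot η p q c s) = 1 + A * B := by
    ext i j
    rw [LinearMap.toMatrix'_apply, planeRot_apply]
    simp only [A, B, Matrix.add_apply, Matrix.mul_apply, Fin.sum_univ_two, Matrix.of_apply,
      Pi.add_apply, Pi.smul_apply, smul_eq_mul, Matrix.one_apply, Pi.single_apply,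
      Matrix.cons_val_zero, Matrix.cons_val_one, eq_comm (a := j)]
    ring
  have hBA : (1 + B * A : Matrix (Fin 2) (Fin 2) ℝ) = !![c, -(η q * s); η p * s, c] := by
    ext i j
    fin_cases i <;> fin_cases j <;>
      simp [A, B, Matrix.mul_apply, Pi.single_apply, h, h.symm]
  rw [hAB, Matrix.det_one_add_mul_comm, hBA, Matrix.det_fin_two_of]
  linear_combination hcs

end PlaneRot

/-! ### The group generated by the plane rotations and boosts -/

variable {m n : ℕ}

/-- The signs of the standard form of signature `(m, n)`. -/
def sgn : Fin m ⊕ Fin n → ℝ := Sum.elim (fun _ => 1) fun _ => -1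

theorem sgn_mul_self (i : Fin m ⊕ Fin n) : sgn i * sgn i = 1 := by
  cases i <;> simp [sgn]

theorem sgn_eq_or (i : Fin m ⊕ Fin n) : sgn i = 1 ∨ sgn i = -1 :=
  mul_self_eq_one_iff.1 (sgn_mul_self i)

theorem sgn_mul_sgn_of_ne {i j : Fin m ⊕ Fin n} (h : sgn i ≠ sgn j) : sgn i * sgn j = -1 := by
  rcases sgn_eq_or i with hp | hp <;> rcases sgn_eq_or j with hq | hq <;> simp_all

theorem stdForm_eq (x : Fin m ⊕ Fin n → ℝ) : stdForm x = ∑ i, sgn i * x i ^ 2 := by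
  simp [stdForm, sgn, Fintype.sum_sum_type, sub_eq_add_neg]

/-- `cos t` in a definite plane, `cosh t` in an indefinite one. -/
def cosPlane (p q : Fin m ⊕ Fin n) (t : ℝ) : ℝ := if sgn p = sgn q then Real.cos t else Real.cosh t

/-- `sin t` in a definite plane, `sinh t` in an indefinite one. -/
def sinPlane (p q : Fin m ⊕ Fin n) (t : ℝ) : ℝ := if sgn p = sgn q then Real.sin t else Real.sinh t

variable {p q : Fin m ⊕ Fin n}

theorem cosPlane_neg (t : ℝ) : cosPlane p q (-t) = cosPlane p q t := by
  simp [cosPlane]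

theorem sinPlane_neg (t : ℝ) : sinPlane p q (-t) = -sinPlane p q t := by
  simp only [sinPlane, Real.sin_neg, Real.sinh_neg]; split_ifs <;> rfl

theorem cosPlane_sq_add (p q : Fin m ⊕ Fin n) (t : ℝ) :
    cosPlane p q t ^ 2 + sgn p * sgn q * sinPlane p q t ^ 2 = 1 := by
  by_cases h : sgn p = sgn q
  · simp [cosPlane, sinPlane, h, sgn_mul_self]
  · simp only [cosPlane, sinPlane, h, sgn_mul_sgn_of_ne h, if_false]
    linarith [Real.cosh_sq t]

theorem continuous_cosPlane : Continuous (cosPlane p q) := by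
  change Continuous fun t => cosPlane p q t
  by_cases h : sgn p = sgn q
  · simpa only [cosPlane, h, if_true] using Real.continuous_cos
  · simpa only [cosPlane, h, if_false] using Real.continuous_cosh

theorem continuous_sinPlane : Continuous (sinPlane p q) := by
  change Continuous fun t => sinPlane p q t
  by_cases h : sgn p = sgn q
  · simpa only [sinPlane, h, if_true] using Real.continuous_sin
  · simpa only [sinPlane, h, if_false] using Real.continuous_sinh

/-- The rotation or boost by `t` in the `pq`-plane. -/
abbrev planeLin (p q : Fin m ⊕ Fin n) (t : ℝ) : (Fin m ⊕ Fin n → ℝ) →ₗ[ℝ] Fin m ⊕ Fin n → ℝ :=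
  planeRot sgn p q (cosPlane p q t) (sinPlane p q t)

theorem planeLin_planeLin_neg (h : p ≠ q) (t : ℝ) (v : Fin m ⊕ Fin n → ℝ) :
    planeLin p q t (planeLin p q (-t) v) = v := by
  have := cosPlane_sq_add p q t
  rw [planeLin, planeLin, planeRot_planeRot h, cosPlane_neg, sinPlane_neg]
  convert planeRot_one_zero (η := sgn) (p := p) (q := q) v using 3
  · linear_combination this
  · ring

theorem toMatrix'_planeLin_mul_neg (h : p ≠ q) (t : ℝ) :
    LinearMap.toMatrix' (planeLin p q t) * LinearMap.toMatrix' (planeLin p q (-t)) = 1 := by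
  rw [← LinearMap.toMatrix'_comp, ← LinearMap.toMatrix'_id]
  congr 1
  exact LinearMap.ext (planeLin_planeLin_neg h t)

/-- The rotation or boost by `t` in the `pq`-plane, as an invertible matrix. -/
def planeGL (h : p ≠ q) (t : ℝ) : GL (Fin m ⊕ Fin n) ℝ where
  val := LinearMap.toMatrix' (planeLin p q t)
  inv := LinearMap.toMatrix' (planeLin p q (-t))
  val_inv := toMatrix'_planeLin_mul_neg h t
  inv_val := by simpa using toMatrix'_planeLin_mul_neg h (-t)

theorem planeGL_mulVec (h : p ≠ q) (t : ℝ) (v : Fin m ⊕ Fin n → ℝ) :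
    (planeGL h t).1 *ᵥ v = planeLin p q t v := by
  rw [planeGL, LinearMap.toMatrix'_mulVec]

variable (m n) in
/-- The group generated by the rotations and boosts in the coordinate planes. -/
def planeGroup : Subgroup (GL (Fin m ⊕ Fin n) ℝ) :=
  Subgroup.closure {A | ∃ (p q : Fin m ⊕ Fin n) (h : p ≠ q) (t : ℝ), A = planeGL h t}

theorem planeGL_mem (h : p ≠ q) (t : ℝ) : planeGL h t ∈ planeGroup m n :=
  Subgroup.subset_closure ⟨p, q, h, t, rfl⟩

theorem planeGL_mem_SO (h : p ≠ q) (t : ℝ) : planeGL h t ∈ SO m n := by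
  refine ⟨fun x => ?_, det_toMatrix'_planeRot h (cosPlane_sq_add p q t)⟩
  rw [planeGL_mulVec, stdForm_eq, stdForm_eq]
  exact sum_mul_planeRot_sq h (cosPlane_sq_add p q t) x

theorem continuous_planeGL (h : p ≠ q) : Continuous (planeGL h) := by
  have hc : Continuous fun t => LinearMap.toMatrix' (planeLin p q t) := by
    refine continuous_matrix fun i j => ?_
    simp only [LinearMap.toMatrix'_apply, planeRot_apply, Pi.add_apply, Pi.smul_apply]
    have h1 := continuous_cosPlane (p := p) (q := q)
    have h2 := continuous_sinPlane (p := p) (q := q)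
    fun_prop
  exact Units.continuous_iff.2 ⟨hc, hc.comp continuous_neg⟩

theorem planeGL_zero (h : p ≠ q) : planeGL h 0 = 1 := by
  have h0 : planeLin p q 0 = LinearMap.id := by
    refine LinearMap.ext fun v => ?_
    have h1 : cosPlane p q 0 = 1 := by simp [cosPlane]
    have h2 : sinPlane p q 0 = 0 := by simp [sinPlane]
    rw [planeLin, h1, h2, planeRot_one_zero, LinearMap.id_apply]
  ext1
  change LinearMap.toMatrix' (planeLin p q 0) = 1
  rw [h0, LinearMap.toMatrix'_id]

theorem planeGroup_le_SO0 : planeGroup m n ≤ SO0 m n := by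
  rw [planeGroup, Subgroup.closure_le]
  rintro _ ⟨p, q, h, t, rfl⟩
  refine ⟨⟨planeGL h t, planeGL_mem_SO h t⟩, ?_, rfl⟩
  have hc : Continuous fun t => (⟨planeGL h t, planeGL_mem_SO h t⟩ : SO m n) :=
    (continuous_planeGL h).subtype_mk _
  refine (isPreconnected_range hc).subset_connectedComponent ⟨0, ?_⟩ ⟨t, rfl⟩
  exact Subtype.ext (planeGL_zero h)

theorem SO0_le_SO : SO0 m n ≤ SO m n := by
  rintro _ ⟨A, -, rfl⟩
  exact A.2

theorem det_toBlocks₁₁_ne_zero {A : GL (Fin m ⊕ Fin n) ℝ} (hA : A ∈ SO m n) :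
    A.1.toBlocks₁₁.det ≠ 0 := by
  intro h
  obtain ⟨x, hx, h0⟩ := Matrix.exists_mulVec_eq_zero_iff.2 h
  have h1 := hA.1 (Sum.elim x 0)
  rw [← Matrix.fromBlocks_toBlocks A.1, Matrix.fromBlocks_mulVec] at h1
  simp only [stdForm, Sum.elim_inl, Sum.elim_inr, Sum.elim_comp_inl, Sum.elim_comp_inr, h0,
    Matrix.mulVec_zero, add_zero, Pi.zero_apply] at h1
  have h2 : 0 ≤ ∑ i, (A.1.toBlocks₂₁ *ᵥ x) i ^ 2 := Finset.sum_nonneg fun i _ => sq_nonneg _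
  have h3 : 0 ≤ ∑ i, x i ^ 2 := Finset.sum_nonneg fun i _ => sq_nonneg _
  have h4 : ∑ i, x i ^ 2 = 0 := by
    simp at h1
    linarith
  apply hx
  ext i
  have := (Finset.sum_eq_zero_iff_of_nonneg fun i _ => sq_nonneg (x i)).1 h4 i (Finset.mem_univ i)
  exact pow_eq_zero_iff two_ne_zero |>.1 this

/-- The determinant of the upper left block does not vanish on `SO(m, n)`; so it is positive on
the identity component. -/
theorem det_toBlocks₁₁_pos {A : GL (Fin m ⊕ Fin n) ℝ} (hA : A ∈ SO0 m n) :
    0 < A.1.toBlocks₁₁.det := by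
  obtain ⟨A, hA, rfl⟩ := hA
  let f : SO m n → ℝ := fun A => A.1.1.toBlocks₁₁.det
  have hf : Continuous f := by
    have : Continuous fun A : SO m n => A.1.1 := Units.continuous_val.comp continuous_subtype_val
    refine Continuous.matrix_det (continuous_matrix fun i j => ?_)
    exact this.matrix_elem _ _
  have h1 : f 1 = 1 := by
    have : (1 : Matrix (Fin m ⊕ Fin n) (Fin m ⊕ Fin n) ℝ).toBlocks₁₁ = 1 := by
      rw [← Matrix.fromBlocks_one, Matrix.toBlocks_fromBlocks₁₁]
    simp only [f, Subgroup.coe_one, Units.val_one, this, Matrix.det_one]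
  by_contra! hneg
  have hpre : IsPreconnected (f '' connectedComponent 1) :=
    isPreconnected_connectedComponent.image f hf.continuousOn
  obtain ⟨B, -, hB⟩ := hpre.ordConnected.out ⟨A, hA, rfl⟩ ⟨1, mem_connectedComponent, rfl⟩
    ⟨hneg, by rw [h1]; exact zero_le_one⟩
  exact det_toBlocks₁₁_ne_zero B.2 hB

end PlaneGroup

section Elimination

variable {m n : ℕ} {p q : Fin m ⊕ Fin n}

/-! ### Reduction to diagonal form -/

theorem planeGroup_le_SO : planeGroup m n ≤ SO m n := planeGroup_le_SO0.trans SO0_le_SO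

/-- The bilinear form polarizing the standard quadratic form. -/
def stdBilin (x y : Fin m ⊕ Fin n → ℝ) : ℝ := ∑ i, sgn i * x i * y i

theorem stdForm_add (x y : Fin m ⊕ Fin n → ℝ) :
    stdForm (x + y) = stdForm x + stdForm y + 2 * stdBilin x y := by
  rw [stdForm_eq, stdForm_eq, stdForm_eq, stdBilin, Finset.mul_sum, ← Finset.sum_add_distrib,
    ← Finset.sum_add_distrib]
  refine Finset.sum_congr rfl fun i _ => ?_
  rw [Pi.add_apply]; ring

theorem stdBilin_mulVec {A : GL (Fin m ⊕ Fin n) ℝ} (hA : A ∈ SO m n) (x y : Fin m ⊕ Fin n → ℝ) :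
    stdBilin (A.1 *ᵥ x) (A.1 *ᵥ y) = stdBilin x y := by
  have h := hA.1 (x + y)
  rw [Matrix.mulVec_add, stdForm_add, stdForm_add, hA.1, hA.1] at h
  linarith

theorem stdBilin_single_right (x : Fin m ⊕ Fin n → ℝ) (j : Fin m ⊕ Fin n) (a : ℝ) :
    stdBilin x (a • Pi.single j 1) = a * (sgn j * x j) := by
  simp [stdBilin, Pi.single_apply]; ring

theorem stdForm_single (j : Fin m ⊕ Fin n) (a : ℝ) :
    stdForm (a • Pi.single j 1 : Fin m ⊕ Fin n → ℝ) = sgn j * a ^ 2 := by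
  simp [stdForm_eq, Pi.single_apply]

/-- A plane rotation or boost annihilates one of two coordinates, unless they span a light-like
vector. -/
theorem exists_planeLin_eq_zero (hpq : p ≠ q) {v : Fin m ⊕ Fin n → ℝ} (hp : v p ≠ 0)
    (h : sgn p = sgn q ∨ v p ^ 2 ≠ v q ^ 2) :
    ∃ t, planeLin p q t v p = 0 ∨ planeLin p q t v q = 0 := by
  -- an indefinite plane: `tanh t = η x / y` is solvable as `|x| < |y|`
  have hcs : ∀ {x y : ℝ}, x ^ 2 < y ^ 2 → ∀ η : ℝ, η * η = 1 →
      ∃ t, Real.sinh t * y = η * x * Real.cosh t := by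
    intro x y hxy η hη
    have hy : y ≠ 0 := by rintro rfl; nlinarith [sq_nonneg x]
    have hmem : η * x / y ∈ Set.Ioo (-1 : ℝ) 1 := by
      rw [Set.mem_Ioo, ← abs_lt, ← sq_lt_one_iff_abs_lt_one, div_pow, div_lt_one (by positivity)]
      calc (η * x) ^ 2 = (η * η) * x ^ 2 := by ring
        _ < y ^ 2 := by rw [hη, one_mul]; exact hxy
    refine ⟨Real.artanh (η * x / y), ?_⟩
    have ht := Real.tanh_artanh hmem
    rw [Real.tanh_eq_sinh_div_cosh, div_eq_div_iff (Real.cosh_pos _).ne' hy] at ht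
    exact ht
  by_cases hs : sgn p = sgn q
  · refine ⟨Real.arctan (-(sgn p * v q) / v p), .inr ?_⟩
    set t := Real.arctan (-(sgn p * v q) / v p)
    have ht : Real.tan t = -(sgn p * v q) / v p := Real.tan_arctan _
    rw [Real.tan_eq_sin_div_cos, div_eq_div_iff (Real.cos_arctan_pos _).ne' hp] at ht
    rw [planeLin, planeRot_apply_snd hpq, cosPlane, sinPlane, if_pos hs, if_pos hs]
    linear_combination sgn p * ht - (v q * Real.cos t) * sgn_mul_self p
  · rcases lt_or_gt_of_ne (h.resolve_left hs) with hlt | hlt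
    · obtain ⟨t, ht⟩ := hcs hlt (sgn q) (sgn_mul_self q)
      refine ⟨t, .inl ?_⟩
      rw [planeLin, planeRot_apply_fst hpq, cosPlane, sinPlane, if_neg hs, if_neg hs]
      linear_combination -sgn q * ht - (v p * Real.cosh t) * sgn_mul_self q
    · obtain ⟨t, ht⟩ := hcs hlt (-sgn p) (by rw [neg_mul_neg, sgn_mul_self])
      refine ⟨t, .inr ?_⟩
      rw [planeLin, planeRot_apply_snd hpq, cosPlane, sinPlane, if_neg hs, if_neg hs]
      linear_combination sgn p * ht - (v q * Real.cosh t) * sgn_mul_self p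

theorem planeGL_mulVec_single_of_ne (hpq : p ≠ q) (t : ℝ) {i : Fin m ⊕ Fin n} (hp : i ≠ p)
    (hq : i ≠ q) : (planeGL hpq t).1 *ᵥ Pi.single i 1 = Pi.single i 1 := by
  rw [planeGL_mulVec, planeLin, planeRot_single_of_ne _ hp hq]

/-- A vector that is supported off `S` and has the norm of the `j`-th basis vector is moved to a
multiple `± e_j` by plane rotations and boosts which fix the basis vectors in `S`. -/
theorem exists_mulVec_eq_single (S : Finset (Fin m ⊕ Fin n)) {j : Fin m ⊕ Fin n} (hj : j ∉ S)
    (N : ℕ) (v : Fin m ⊕ Fin n → ℝ) (hN : (Finset.univ.filter fun i => v i ≠ 0).card ≤ N)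
    (hS : ∀ i ∈ S, v i = 0) (hv : stdForm v = sgn j) :
    ∃ A ∈ planeGroup m n, (∀ i ∈ S, A.1 *ᵥ Pi.single i 1 = Pi.single i 1) ∧
      ∃ a : ℝ, a * a = 1 ∧ A.1 *ᵥ v = a • Pi.single j 1 := by
  induction N generalizing v with
  | zero =>
    exfalso
    have h0 : ∀ i, v i = 0 := by
      intro i
      by_contra h
      exact (Finset.card_pos.2 ⟨i, Finset.mem_filter.2 ⟨Finset.mem_univ i, h⟩⟩).ne'
        (Nat.le_zero.1 hN)
    have : stdForm v = 0 := by simp [stdForm_eq, h0]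
    have h1 := sgn_mul_self j
    rw [← hv, this] at h1
    norm_num at h1
  | succ N ih =>
    by_cases hex : ∃ p q, p ≠ q ∧ v p ≠ 0 ∧ v q ≠ 0 ∧ (sgn p = sgn q ∨ v p ^ 2 ≠ v q ^ 2)
    · -- a plane rotation or boost makes the support smaller
      obtain ⟨p, q, hpq, hp, hq, h⟩ := hex
      obtain ⟨t, ht⟩ := exists_planeLin_eq_zero hpq hp h
      have hpS : p ∉ S := fun h => hp (hS p h)
      have hqS : q ∉ S := fun h => hq (hS q h)
      have hpi : ∀ i ∈ S, i ≠ p := fun i hi h => hpS (h ▸ hi)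
      have hqi : ∀ i ∈ S, i ≠ q := fun i hi h => hqS (h ▸ hi)
      have hsub : (Finset.univ.filter fun i => planeLin p q t v i ≠ 0) ⊂
          Finset.univ.filter fun i => v i ≠ 0 := by
        rw [Finset.ssubset_iff_of_subset]
        · rcases ht with ht | ht
          · exact ⟨p, by simpa using hp, by simpa using ht⟩
          · exact ⟨q, by simpa using hq, by simpa using ht⟩
        · intro i hi
          rw [Finset.mem_filter] at hi ⊢
          refine ⟨Finset.mem_univ i, ?_⟩
          by_cases h1 : i = p
          · rwa [h1]
          by_cases h2 : i = q
          · rwa [h2]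
          have := hi.2
          rwa [planeLin, planeRot_apply_of_ne h1 h2] at this
      obtain ⟨A, hA, hAS, a, ha, hAv⟩ := ih (planeLin p q t v)
        (Nat.le_of_lt_succ ((Finset.card_lt_card hsub).trans_le hN))
        (fun i hi => by
          rw [planeLin, planeRot_apply_of_ne (hpi i hi) (hqi i hi), hS i hi])
        (by rw [← planeGL_mulVec hpq, (planeGL_mem_SO hpq t).1, hv])
      refine ⟨A * planeGL hpq t, mul_mem hA (planeGL_mem hpq t), fun i hi => ?_, a, ha, ?_⟩
      · rw [Units.val_mul, ← Matrix.mulVec_mulVec, planeGL_mulVec_single_of_ne hpq t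
          (hpi i hi) (hqi i hi), hAS i hi]
      · rw [Units.val_mul, ← Matrix.mulVec_mulVec, planeGL_mulVec, hAv]
    · push Not at hex
      have hne : stdForm v ≠ 0 := by
        rw [hv]
        intro h0
        simpa [h0] using sgn_mul_self j
      obtain ⟨p, hp⟩ : ∃ p, v p ≠ 0 := by
        by_contra! h0
        exact hne (by simp [stdForm_eq, h0])
      -- two nonzero coordinates have opposite signs and cancel, and a third one is impossible
      have huniq : ∀ q, q ≠ p → v q = 0 := by
        intro q hq
        by_contra hvq
        have h1 := hex p q hq.symm hp hvq
        refine hne ?_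
        rw [stdForm_eq, Finset.sum_eq_add p q hq.symm, h1.2]
        · have := sgn_mul_sgn_of_ne h1.1
          have h2 : sgn p + sgn q = 0 := by
            rcases sgn_eq_or p with h | h <;> rw [h] at this ⊢ <;> linarith
          rw [← add_mul, h2, zero_mul]
        · rintro r - ⟨hrp, hrq⟩
          by_contra hr
          have hvr : v r ≠ 0 := by rintro h; simp [h] at hr
          have h2 := (hex p r hrp.symm hp hvr).1
          have h3 := (hex q r hrq.symm hvq hvr).1
          rcases sgn_eq_or p with h | h <;> rcases sgn_eq_or q with h' | h' <;>
            rcases sgn_eq_or r with h'' | h'' <;> simp_all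
        · exact fun h => absurd (Finset.mem_univ p) h
        · exact fun h => absurd (Finset.mem_univ q) h
      have hvp : v = v p • Pi.single p 1 := by
        ext i
        by_cases h : i = p
        · subst h; simp
        · simp [h, huniq i h]
      rw [hvp, stdForm_single] at hv
      have hsgn : sgn p = sgn j := by
        by_contra h
        have : v p ^ 2 = -1 := by
          linear_combination sgn p * hv - v p ^ 2 * sgn_mul_self p + sgn_mul_sgn_of_ne h
        linarith [sq_nonneg (v p)]
      have hsq : v p * v p = 1 := by
        rw [hsgn] at hv
        have := sgn_mul_self j
        linear_combination sgn j * hv + (1 - v p * v p) * this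
      by_cases hpj : p = j
      · subst hpj
        exact ⟨1, one_mem _, fun i _ => by rw [Units.val_one, Matrix.one_mulVec], v p, hsq,
          by rwa [Units.val_one, Matrix.one_mulVec]⟩
      · refine ⟨planeGL hpj (Real.pi / 2), planeGL_mem _ _, fun i hi => ?_, v p * sgn p, ?_, ?_⟩
        · refine planeGL_mulVec_single_of_ne _ _ ?_ ?_
          · rintro rfl; exact hp (hS i hi)
          · rintro rfl; exact hj hi
        · linear_combination hsq + (v p * v p) * sgn_mul_self p
        · rw [planeGL_mulVec, hvp, map_smul, planeLin, planeRot_single_fst _ hpj, cosPlane,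
            sinPlane, if_pos hsgn, if_pos hsgn, Real.cos_pi_div_two, Real.sin_pi_div_two]
          simp [smul_smul]

/-- Plane rotations and boosts reduce `A` to a diagonal matrix of signs. -/
theorem exists_mul_diagonal {A : GL (Fin m ⊕ Fin n) ℝ} (hA : A ∈ SO m n)
    (S : Finset (Fin m ⊕ Fin n)) :
    ∃ B ∈ planeGroup m n, ∀ i ∈ S, ∃ a : ℝ, a * a = 1 ∧
      (B * A).1 *ᵥ Pi.single i 1 = a • Pi.single i 1 := by
  induction S using Finset.induction_on with
  | empty => exact ⟨1, one_mem _, by simp⟩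
  | insert j S hj ih =>
    obtain ⟨B, hB, h⟩ := ih
    have hBA : B * A ∈ SO m n := mul_mem (planeGroup_le_SO hB) hA
    -- the images of the basis vectors in `S` are orthogonal to the image of the new one
    have hS : ∀ i ∈ S, ((B * A).1 *ᵥ Pi.single j 1) i = 0 := by
      intro i hi
      obtain ⟨a, ha, hai⟩ := h i hi
      have h1 := stdBilin_mulVec hBA (Pi.single j 1) (Pi.single i 1)
      have hij : i ≠ j := by rintro rfl; exact hj hi
      have h2 := stdBilin_single_right (Pi.single j (1 : ℝ)) i 1
      rw [one_smul, Pi.single_eq_of_ne hij, mul_zero, mul_zero] at h2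
      rw [hai, stdBilin_single_right, h2] at h1
      have ha0 : a ≠ 0 := by rintro rfl; simp at ha
      have hs0 : sgn i ≠ 0 := fun h0 => by simpa [h0] using sgn_mul_self i
      exact (mul_eq_zero.1 ((mul_eq_zero.1 h1).resolve_left ha0)).resolve_left hs0
    have hnorm : stdForm ((B * A).1 *ᵥ Pi.single j 1) = sgn j := by
      have := stdForm_single j (1 : ℝ)
      rwa [one_smul, one_pow, mul_one, ← hBA.1] at this
    obtain ⟨C, hC, hCS, a, ha, hCv⟩ := exists_mulVec_eq_single S hj _ _ le_rfl hS hnorm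
    refine ⟨C * B, mul_mem hC hB, fun i hi => ?_⟩
    rw [mul_assoc, Units.val_mul]
    rcases Finset.mem_insert.1 hi with rfl | hi
    · exact ⟨a, ha, by rw [← Matrix.mulVec_mulVec, hCv]⟩
    · obtain ⟨b, hb, hbi⟩ := h i hi
      exact ⟨b, hb, by rw [← Matrix.mulVec_mulVec, hbi, Matrix.mulVec_smul, hCS i hi]⟩

section

variable {H : Subgroup (GL (Fin m ⊕ Fin n) ℝ)} (hG : planeGroup m n ≤ H) (hSO : H ≤ SO m n)
  (hpos : ∀ A ∈ H, 0 < A.1.toBlocks₁₁.det)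
include hG hSO hpos

/-- The entries `-1` of a diagonal matrix in `H` come in pairs of the same sign, and such a pair is
a rotation by `π`. -/
theorem mem_planeGroup_of_diagonal (N : ℕ) {D : GL (Fin m ⊕ Fin n) ℝ} (hD : D ∈ H)
    {d : Fin m ⊕ Fin n → ℝ} (hd : ∀ i, d i * d i = 1)
    (h : ∀ i, D.1 *ᵥ Pi.single i 1 = d i • Pi.single i 1)
    (hN : (Finset.univ.filter fun i => d i ≠ 1).card ≤ N) : D ∈ planeGroup m n := by
  induction N generalizing D d with
  | zero =>
    have hd1 : ∀ i, d i = 1 := by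
      intro i
      by_contra h
      exact (Finset.card_pos.2 ⟨i, Finset.mem_filter.2 ⟨Finset.mem_univ i, h⟩⟩).ne'
        (Nat.le_zero.1 hN)
    have : D = 1 := by
      ext i j
      have := congrFun (h j) i
      rw [Matrix.mulVec_single_one, Matrix.col_apply] at this
      rw [this, hd1, one_smul, Units.val_one, Matrix.one_apply, Pi.single_apply]
    rw [this]
    exact one_mem _
  | succ N ih =>
    by_cases hall : ∀ i, d i = 1
    · exact ih hD hd h (by simp [hall])
    push Not at hall
    obtain ⟨i, hi⟩ := hall
    have hi' : d i = -1 := (mul_self_eq_one_iff.1 (hd i)).resolve_left hi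
    have hdiag : D.1 = Matrix.diagonal d := by
      ext i j
      have := congrFun (h j) i
      rw [Matrix.mulVec_single_one, Matrix.col_apply] at this
      rw [this, Matrix.diagonal_apply, Pi.smul_apply, Pi.single_apply]
      by_cases hij : i = j
      · subst hij; simp
      · simp [hij]
    obtain ⟨j, hji, hsgn, hj⟩ : ∃ j, j ≠ i ∧ sgn j = sgn i ∧ d j ≠ 1 := by
      by_contra! hno
      have h1 := (hSO hD).2
      have h2 := hpos D hD
      have hb : (Matrix.diagonal d).toBlocks₁₁ = Matrix.diagonal fun a => d (Sum.inl a) := by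
        ext a b
        simp [Matrix.toBlocks₁₁, Matrix.diagonal_apply]
      rw [hdiag, hb, Matrix.det_diagonal] at h2
      rw [hdiag, Matrix.det_diagonal, Fintype.prod_sum_type] at h1
      rcases i with a | a
      · rw [Finset.prod_eq_single a (fun b _ hb => hno _ (by simpa using hb) (by simp [sgn]))
          (fun h => absurd (Finset.mem_univ a) h), hi'] at h2
        linarith
      · rw [Finset.prod_eq_single (s := (Finset.univ : Finset (Fin n))) a
          (fun b _ hb => hno _ (by simpa using hb) (by simp [sgn]))
          (fun h => absurd (Finset.mem_univ a) h), hi'] at h1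
        linarith
    have hj' : d j = -1 := (mul_self_eq_one_iff.1 (hd j)).resolve_left hj
    have hrot := planeGL_mem hji.symm Real.pi
    have hc : cosPlane i j Real.pi = -1 := by rw [cosPlane, if_pos hsgn.symm, Real.cos_pi]
    have hs : sinPlane i j Real.pi = 0 := by rw [sinPlane, if_pos hsgn.symm, Real.sin_pi]
    have hmem : planeGL hji.symm Real.pi * D ∈ planeGroup m n := by
      refine ih (mul_mem (hG hrot) hD) (d := fun l => if l = i ∨ l = j then 1 else d l) ?_ ?_ ?_
      · intro l
        split_ifs
        · exact one_mul 1
        · exact hd l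
      · intro l
        rw [Units.val_mul, ← Matrix.mulVec_mulVec, h, Matrix.mulVec_smul, planeGL_mulVec]
        by_cases hli : l = i
        · subst hli
          rw [planeLin, planeRot_single_fst _ hji.symm, hc, hs, hi']
          simp
        by_cases hlj : l = j
        · subst hlj
          rw [planeLin, planeRot_single_snd _ hji.symm, hc, hs, hj']
          simp
        rw [planeLin, planeRot_single_of_ne _ hli hlj]
        simp [hli, hlj]
      · refine Nat.le_of_lt_succ (lt_of_lt_of_le (Finset.card_lt_card ?_) hN)
        rw [Finset.ssubset_iff_of_subset]
        · exact ⟨i, by simpa using hi, by simp⟩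
        · intro l hl
          simp only [Finset.mem_filter, Finset.mem_univ, true_and] at hl ⊢
          intro hl1
          exact hl (by simp [hl1])
    have := mul_mem (inv_mem hrot) hmem
    rwa [inv_mul_cancel_left] at this

/-- A group between `planeGroup` and `SO(m, n)` on which the determinant of the upper left block is
positive is generated by the plane rotations and boosts. -/
theorem le_planeGroup : H ≤ planeGroup m n := by
  intro A hA
  obtain ⟨B, hB, h⟩ := exists_mul_diagonal (hSO hA) Finset.univ
  choose d hd hBA using fun i => h i (Finset.mem_univ i)
  have := mem_planeGroup_of_diagonal hG hSO hpos _ (mul_mem (hG hB) hA) hd hBA le_rfl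
  have := mul_mem (inv_mem hB) this
  rwa [inv_mul_cancel_left] at this

end

theorem SO0_eq_planeGroup : SO0 m n = planeGroup m n :=
  le_antisymm (le_planeGroup planeGroup_le_SO0 SO0_le_SO fun _ => det_toBlocks₁₁_pos)
    planeGroup_le_SO0

theorem SO0_zero_right : SO0 m 0 = SO m 0 := by
  refine le_antisymm SO0_le_SO ?_
  rw [SO0_eq_planeGroup]
  refine le_planeGroup planeGroup_le_SO le_rfl fun A hA => ?_
  have h := hA.2
  rw [← Matrix.fromBlocks_toBlocks A.1, Subsingleton.elim A.1.toBlocks₂₁ 0,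
    Matrix.det_fromBlocks_zero₂₁, Matrix.det_isEmpty (A := A.1.toBlocks₂₂),
    mul_one] at h
  rw [h]
  exact one_pos

end Elimination

section Generation

/-! ### The generated groups -/

section Rep

variable {m n : ℕ} {V : Type*} [AddCommGroup V] [Module ℝ V]

/-- The action of matrices on a space with linear coordinates. -/
def rep (c : V ≃ₗ[ℝ] (Fin m ⊕ Fin n → ℝ)) : GL (Fin m ⊕ Fin n) ℝ →* (V ≃ₗ[ℝ] V) where
  toFun A := LinearEquiv.ofLinearMap
    (c.symm.toLinearMap ∘ₗ Matrix.toLin' A.1 ∘ₗ c.toLinearMap)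
    (c.symm.toLinearMap ∘ₗ Matrix.toLin' (A⁻¹).1 ∘ₗ c.toLinearMap)
    (LinearMap.ext fun x => by
      simp only [LinearMap.comp_apply, LinearEquiv.coe_coe, LinearEquiv.apply_symm_apply,
        Matrix.toLin'_apply, Matrix.mulVec_mulVec, Units.mul_inv, Matrix.one_mulVec,
        LinearEquiv.symm_apply_apply, LinearMap.id_apply])
    (LinearMap.ext fun x => by
      simp only [LinearMap.comp_apply, LinearEquiv.coe_coe, LinearEquiv.apply_symm_apply,
        Matrix.toLin'_apply, Matrix.mulVec_mulVec, Units.inv_mul, Matrix.one_mulVec,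
        LinearEquiv.symm_apply_apply, LinearMap.id_apply])
  map_one' := LinearEquiv.ext fun x => by simp
  map_mul' A B := LinearEquiv.ext fun x => by simp

theorem rep_apply (c : V ≃ₗ[ℝ] (Fin m ⊕ Fin n → ℝ)) (A : GL (Fin m ⊕ Fin n) ℝ) (X : V) :
    rep c A X = c.symm (A.1 *ᵥ c X) := rfl

theorem rep_injective (c : V ≃ₗ[ℝ] (Fin m ⊕ Fin n → ℝ)) : Function.Injective (rep c) := by
  intro A B h
  ext1
  refine Matrix.mulVec_injective (funext fun v => ?_)
  have := congrArg c (LinearEquiv.congr_fun h (c.symm v))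
  simpa only [rep_apply, LinearEquiv.apply_symm_apply] using this

end Rep

variable {k' k : Label}

/-- Whether the norm of a direction is positive. -/
def isPos : Dir k' k → Bool
  | .inl _ => true
  | .inr i => decide (i.1 < 4)

theorem g_eq_ite (p : Dir k' k) : g p = if isPos p then 1 else -1 := by
  rcases p with p | p <;> simp [g, isPos]

variable (k' k) in
theorem card_isPos : Fintype.card {p : Dir k' k // isPos p} = k.dim + k'.pos := by
  cases k <;> cases k' <;> rfl

variable (k' k) in
theorem card_not_isPos : Fintype.card {p : Dir k' k // ¬isPos p} = k'.neg := by
  cases k <;> cases k' <;> rfl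

variable (k' k) in
/-- A numbering of the directions, those of positive norm first. -/
def dirEquiv : Dir k' k ≃ Fin (k.dim + k'.pos) ⊕ Fin k'.neg :=
  (Equiv.sumCompl fun p : Dir k' k => (isPos p : Prop)).symm.trans
    (Equiv.sumCongr (Fintype.equivFinOfCardEq (card_isPos k' k))
      (Fintype.equivFinOfCardEq (card_not_isPos k' k)))

theorem sgn_dirEquiv (p : Dir k' k) : sgn (dirEquiv k' k p) = g p := by
  rw [g_eq_ite]
  by_cases h : isPos p
  · rw [if_pos h, dirEquiv, Equiv.trans_apply,
      Equiv.sumCompl_symm_apply_of_pos (p := fun p : Dir k' k => (isPos p : Prop)) h]; rfl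
  · rw [if_neg h, dirEquiv, Equiv.trans_apply,
      Equiv.sumCompl_symm_apply_of_neg (p := fun p : Dir k' k => (isPos p : Prop)) h]; rfl

theorem planeRot_dirEquiv (p q : Dir k' k) (c s : ℝ) (w : Fin (k.dim + k'.pos) ⊕ Fin k'.neg → ℝ) :
    planeRot sgn (dirEquiv k' k p) (dirEquiv k' k q) c s w ∘ dirEquiv k' k =
      planeRot g p q c s (w ∘ dirEquiv k' k) := by
  ext r
  simp [planeRot_apply, Pi.single_apply, sgn_dirEquiv]

theorem orient_eq_or (p q : Dir k' k) : orient p q = 1 ∨ orient p q = -1 := by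
  unfold orient
  split_ifs
  · exact .inl rfl
  · exact g_eq_or p

theorem cosPlane_dirEquiv (p q : Dir k' k) (θ : ℝ) :
    cosPlane (dirEquiv k' k p) (dirEquiv k' k q) (orient p q * θ) = cFun p q θ := by
  rcases orient_eq_or p q with h | h <;> rw [h]
  · rw [one_mul, cosPlane, sgn_dirEquiv, sgn_dirEquiv]; rfl
  · rw [neg_one_mul, cosPlane_neg, cosPlane, sgn_dirEquiv, sgn_dirEquiv]; rfl

theorem sinPlane_dirEquiv (p q : Dir k' k) (θ : ℝ) :
    sinPlane (dirEquiv k' k p) (dirEquiv k' k q) (orient p q * θ) = orient p q * sFun p q θ := by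
  rcases orient_eq_or p q with h | h <;> rw [h]
  · rw [one_mul, one_mul, sinPlane, sgn_dirEquiv, sgn_dirEquiv]; rfl
  · rw [neg_one_mul, neg_one_mul, sinPlane_neg, sinPlane, sgn_dirEquiv, sgn_dirEquiv]; rfl

theorem form_comb_comp_dirEquiv (w : Fin (k.dim + k'.pos) ⊕ Fin k'.neg → ℝ) :
    form (comb (w ∘ dirEquiv k' k)) (comb (w ∘ dirEquiv k' k)) = stdForm w := by
  rw [form_comb_comb, stdForm_eq, ← (dirEquiv k' k).sum_comp]
  simp only [sgn_dirEquiv, Function.comp_apply]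

section Coord

variable {W : Type*} [AddCommGroup W] [Module ℝ W] {Ψ : SplitOct × Oct →ₗ[ℝ] W}
  {V : Submodule ℝ W} (hΨ : Function.Injective Ψ)
  (hV : LinearMap.range (Ψ ∘ₗ (comb : (Dir k' k → ℝ) →ₗ[ℝ] SplitOct × Oct)) = V)

/-- The coordinates on the image of `𝕂' ⊕ 𝕂` under an injective linear map. -/
def coordOf : V ≃ₗ[ℝ] (Fin (k.dim + k'.pos) ⊕ Fin k'.neg → ℝ) :=
  ((LinearEquiv.ofInjective (Ψ ∘ₗ (comb : (Dir k' k → ℝ) →ₗ[ℝ] SplitOct × Oct))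
    (hΨ.comp comb_injective)).trans (LinearEquiv.ofEq _ _ hV)).symm.trans
      (LinearEquiv.funCongrLeft ℝ ℝ (dirEquiv k' k).symm)

theorem coordOf_symm_apply (w : Fin (k.dim + k'.pos) ⊕ Fin k'.neg → ℝ) :
    ((coordOf hΨ hV).symm w : W) = Ψ (comb (w ∘ dirEquiv k' k)) := rfl

theorem coe_eq (X : V) : (X : W) = Ψ (comb (coordOf hΨ hV X ∘ dirEquiv k' k)) := by
  rw [← coordOf_symm_apply hΨ hV, LinearEquiv.symm_apply_apply]

variable {T : Dir k' k → Dir k' k → ℝ → W → W}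
  (hT : ∀ p q, p ≠ q → ∀ θ v, T p q θ (Ψ (comb v)) =
    Ψ (comb (planeRot g p q (cFun p q θ) (orient p q * sFun p q θ) v)))
include hT

theorem rep_planeGL_coe {p q : Dir k' k} (h : p ≠ q) (θ : ℝ) (X : V) :
    (rep (coordOf hΨ hV) (planeGL ((dirEquiv k' k).injective.ne h) (orient p q * θ)) X : W) =
      T p q θ X := by
  rw [rep_apply, coordOf_symm_apply, planeGL_mulVec, planeLin, cosPlane_dirEquiv,
    sinPlane_dirEquiv, planeRot_dirEquiv, ← hT p q h, ← coe_eq]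

/-- The maps `T_pq(θ)` are, in coordinates, the rotations and boosts of all coordinate planes. -/
theorem closure_eq_map_rep :
    Subgroup.closure {f : V ≃ₗ[ℝ] V | ∃ (p q : Dir k' k) (θ : ℝ), p ≠ q ∧
      ∀ X : V, (f X : W) = T p q θ X} =
    (SO0 (k.dim + k'.pos) k'.neg).map (rep (coordOf hΨ hV)) := by
  rw [SO0_eq_planeGroup, planeGroup, MonoidHom.map_closure]
  congr 1
  ext f
  constructor
  · rintro ⟨p, q, θ, h, hf⟩
    refine ⟨_, ⟨_, _, (dirEquiv k' k).injective.ne h, orient p q * θ, rfl⟩, ?_⟩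
    exact LinearEquiv.ext fun X => Subtype.ext (by rw [rep_planeGL_coe hΨ hV hT h, hf])
  · rintro ⟨_, ⟨p', q', h, t, rfl⟩, rfl⟩
    obtain ⟨p, rfl⟩ := (dirEquiv k' k).surjective p'
    obtain ⟨q, rfl⟩ := (dirEquiv k' k).surjective q'
    have hpq : p ≠ q := fun h' => h (by rw [h'])
    have ht : t = orient p q * (orient p q * t) := by
      rcases orient_eq_or p q with ho | ho <;> rw [ho] <;> ring
    refine ⟨p, q, orient p q * t, hpq, fun X => ?_⟩
    rw [← rep_planeGL_coe hΨ hV hT hpq, ← ht]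

end Coord

theorem range_vecMat_comp_comb :
    LinearMap.range (vecMat ∘ₗ (comb : (Dir k' k → ℝ) →ₗ[ℝ] SplitOct × Oct)) = V2 k' k := by
  rw [LinearMap.range_comp, range_comb, V2]

theorem range_Gam_comp_comb :
    LinearMap.range ((Gam ∘ₗ vecMat) ∘ₗ (comb : (Dir k' k → ℝ) →ₗ[ℝ] SplitOct × Oct)) =
      V4 k' k := by
  rw [LinearMap.comp_assoc, LinearMap.range_comp, range_vecMat_comp_comb, V4]

theorem det2_vecMat (z : SplitOct × Oct) : det2 (vecMat z) = -(form z z • (1 : OO)) := by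
  simp [det2, vecMat_apply, mul_conj_self, conj_mul_self, form, Algebra.TensorProduct.one_def,
    ← TensorProduct.smul_tmul', add_smul]
  abel

end Generation

end MagicSquare

end

theorem theorem3 (k' k : Label) :
    -- commuting units: the exponential action is well defined, and it is a rotation or a boost
    (∀ p q : Dir k' k, p ≠ q →
      e p * e q = e q * e p → ∀ θ : ℝ,
      expM p q θ * expMInv p q θ = 1 ∧
      expMInv p q θ * expM p q θ = 1 ∧
      (∀ P ∈ V4 k' k,
        (expM p q θ * P) * expMInv p q θ =
          expM p q θ * (P * expMInv p q θ)) ∧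
      expMap4 p q θ (gam p) =
        cFun p q θ • gam p +
          (g p * sFun p q θ) • gam q ∧
      expMap4 p q θ (gam q) =
        cFun p q θ • gam q -
          (g q * sFun p q θ) • gam p ∧
      ∀ r, r ≠ p → r ≠ q →
        expMap4 p q θ (gam r) = gam r) ∧
    -- otherwise the units anticommute; the nested flip is well defined, a rotation or a boost
    (∀ p q : Dir k' k,
      e p * e q ≠ e q * e p →
      e p * e q = -(e q * e p) ∧ ∀ θ : ℝ,
      (flipM1 p * flipM1Inv p : Mat4) = 1 ∧
      (flipM1Inv p * flipM1 p : Mat4) = 1 ∧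
      (flipM2 p q θ * flipM2Inv p q θ : Mat4) = 1 ∧
      (flipM2Inv p q θ * flipM2 p q θ : Mat4) = 1 ∧
      (∀ P ∈ V4 k' k,
        (flipM1 p * P) * flipM1Inv p =
          flipM1 p * (P * flipM1Inv p) ∧
        (flipM2 p q θ * P) * flipM2Inv p q θ =
          flipM2 p q θ * (P * flipM2Inv p q θ) ∧
        (flipM1 p * P) * flipM1Inv p ∈ V4 k' k) ∧
      nestedFlip p q θ (gam p) =
        cFun p q θ • gam p +
          sFun p q θ • gam q ∧
      nestedFlip p q θ (gam q) =
        cFun p q θ • gam q -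
          (g p * g q * sFun p q θ) • gam p ∧
      ∀ r, r ≠ p → r ≠ q →
        nestedFlip p q θ (gam r) = gam r) ∧
    -- each map is an invertible linear transformation of `V₄`, and of `V₂`; `Γ` intertwines them
    (∀ p q : Dir k' k, p ≠ q → ∀ θ : ℝ,
      (∃ f : V4 k' k ≃ₗ[ℝ] V4 k' k,
        ∀ P : V4 k' k, (f P : Mat4) = planeMap4 p q θ P) ∧
      (∃ f : V2 k' k ≃ₗ[ℝ] V2 k' k,
        ∀ X : V2 k' k, (f X : Mat2) = planeMap2 p q θ X) ∧
      ∀ X ∈ V2 k' k,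
        Gam (planeMap2 p q θ X) =
          planeMap4 p q θ (Gam X)) ∧
    -- the generated groups are faithful images of `SO₀(κ + κ'₊, κ'₋)`, acting in the standard way
    (∃ (coord : V2 k' k ≃ₗ[ℝ] (Fin (k.dim + k'.pos) ⊕ Fin k'.neg → ℝ))
      (τ : Dir k' k ≃ Fin (k.dim + k'.pos) ⊕ Fin k'.neg)
      (ρ₂ : SO0 (k.dim + k'.pos) k'.neg →*
        (V2 k' k ≃ₗ[ℝ] V2 k' k))
      (ρ₄ : SO0 (k.dim + k'.pos) k'.neg →*
        (V4 k' k ≃ₗ[ℝ] V4 k' k)),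
      (∀ p, (coord.symm (Pi.single (τ p) 1) : Mat2) = pauli p) ∧
      (∀ X : V2 k' k,
        det2 X = -(stdForm (coord X) • (1 : OO))) ∧
      (∀ X : V2 k' k,
        Gam X * Gam X =
          stdForm (coord X) • (1 : Mat4)) ∧
      (∀ A X, coord (ρ₂ A X) = (A : GL (Fin (k.dim + k'.pos) ⊕ Fin k'.neg) ℝ).1 *ᵥ coord X) ∧
      (∀ A (X : V2 k' k) (P : V4 k' k),
        (P : Mat4) = Gam X →
          (ρ₄ A P : Mat4) = Gam (ρ₂ A X)) ∧
      Function.Injective ρ₂ ∧ Function.Injective ρ₄ ∧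
      ρ₂.range = SU2 k' k ∧ ρ₄.range = genGroup4 k' k) ∧
    -- in the definite case the identity component is the whole group
    (k'.neg = 0 →
      SO0 (k.dim + k'.pos) k'.neg = SO (k.dim + k'.pos) k'.neg) := by
  have gam_comb : ∀ p : Dir k' k, gam p = Gam (vecMat (comb (Pi.single p 1))) := fun p => by
    rw [comb_single, gam_eq]
  refine ⟨fun p q hpq hc θ => ?_, fun p q hc => ?_, fun p q hpq θ => ?_, ?_, fun hneg => ?_⟩
  · obtain ⟨h, h'⟩ := cliffordPair_of_comm hpq hc
    refine ⟨expM_mul_expMInv h h' θ, expMInv_mul_expM h h' θ, fun P hP => ?_, ?_, ?_,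
      fun r hrp hrq => ?_⟩
    · obtain ⟨v, rfl⟩ := mem_V4_iff.1 hP
      exact expM_mul_assoc h h' θ _
    · rw [gam_comb p, expMap4_comb h h', planeRot_single_fst _ hpq]
      simp only [map_add, map_smul, gam_comb]
    · rw [gam_comb q, expMap4_comb h h', planeRot_single_snd _ hpq]
      simp only [map_sub, map_smul, gam_comb]
    · rw [gam_comb r, expMap4_comb h h', planeRot_single_of_ne _ hrp hrq]
  · have hpq : p ≠ q := by rintro rfl; exact hc rfl
    refine ⟨(exists_actsBy hc 0).1, fun θ => ?_⟩
    obtain ⟨-, φ₁, φ₂, h1, h2, hmem, -⟩ := exists_actsBy hc θ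
    refine ⟨scalarMat_mul_scalarMat h1.mul_inv, scalarMat_mul_scalarMat h1.inv_mul,
      scalarMat_mul_scalarMat h2.mul_inv, scalarMat_mul_scalarMat h2.inv_mul,
      fun P hP => ?_, ?_, ?_, fun r hrp hrq => ?_⟩
    · obtain ⟨v, rfl⟩ := mem_V4_iff.1 hP
      refine ⟨(h1.Gam_vecMat _).trans (h1.Gam_vecMat' _).symm,
        (h2.Gam_vecMat _).trans (h2.Gam_vecMat' _).symm, ?_⟩
      rw [flipM1, flipM1Inv, h1.Gam_vecMat]
      exact ⟨_, ⟨_, hmem v, rfl⟩, rfl⟩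
    · rw [gam_comb p, nestedFlip4_comb hc, planeRot_single_fst _ hpq, ← mul_assoc, g_mul_self,
        one_mul]
      simp only [map_add, map_smul, gam_comb]
    · rw [gam_comb q, nestedFlip4_comb hc, planeRot_single_snd _ hpq]
      simp only [map_sub, map_smul, gam_comb]
      rw [← mul_assoc, mul_comm (g q)]
    · rw [gam_comb r, nestedFlip4_comb hc, planeRot_single_of_ne _ hrp hrq]
  · refine ⟨⟨_, rep_planeGL_coe (Gam_injective.comp vecMat_injective) range_Gam_comp_comb
      (fun p q hpq θ v => planeMap4_comb hpq θ v) hpq θ⟩,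
      ⟨_, rep_planeGL_coe vecMat_injective range_vecMat_comp_comb
        (fun p q hpq θ v => planeMap2_comb hpq θ v) hpq θ⟩, fun X hX => ?_⟩
    obtain ⟨v, rfl⟩ := mem_V2_iff.1 hX
    rw [planeMap2_comb hpq, planeMap4_comb hpq]
  · have h4 : Function.Injective (Gam ∘ₗ vecMat) := Gam_injective.comp vecMat_injective
    let c2 : V2 k' k ≃ₗ[ℝ] _ := coordOf vecMat_injective range_vecMat_comp_comb
    let c4 : V4 k' k ≃ₗ[ℝ] _ := coordOf h4 range_Gam_comp_comb
    have hc2 : ∀ X : V2 k' k, (X : Mat2) = vecMat (comb (c2 X ∘ dirEquiv k' k)) := coe_eq _ _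
    have hc4 : ∀ P : V4 k' k, (P : Mat4) = Gam (vecMat (comb (c4 P ∘ dirEquiv k' k))) :=
      coe_eq h4 range_Gam_comp_comb
    refine ⟨c2, dirEquiv k' k, (rep c2).comp (Subgroup.subtype _),
      (rep c4).comp (Subgroup.subtype _), fun p => ?_, fun X => ?_, fun X => ?_, fun A X => ?_,
      fun A X P hP => ?_, (rep_injective c2).comp Subtype.val_injective,
      (rep_injective c4).comp Subtype.val_injective, ?_, ?_⟩
    · rw [coordOf_symm_apply, pauli_eq, ← comb_single]
      congr 2
      ext r
      simp [Pi.single_apply]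
    · rw [hc2 X, det2_vecMat, form_comb_comp_dirEquiv]
    · rw [hc2 X, Gam_sq, form_comb_comp_dirEquiv]
    · simp only [MonoidHom.comp_apply, rep_apply, LinearEquiv.apply_symm_apply]
      rfl
    · have hPX : c4 P = c2 X := by
        rw [hc4 P, hc2 X] at hP
        have := comb_injective (vecMat_injective (Gam_injective hP))
        exact (dirEquiv k' k).surjective.injective_comp_right this
      simp only [MonoidHom.comp_apply, rep_apply, hPX]
      rfl
    · rw [MonoidHom.range_comp, Subgroup.range_subtype, SU2]
      exact (closure_eq_map_rep vecMat_injective range_vecMat_comp_comb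
        fun p q hpq θ v => planeMap2_comb hpq θ v).symm
    · rw [MonoidHom.range_comp, Subgroup.range_subtype, genGroup4]
      exact (closure_eq_map_rep h4 range_Gam_comp_comb
        fun p q hpq θ v => planeMap4_comb hpq θ v).symm
  · generalize k'.neg = n at hneg
    subst hneg
    exact SO0_zero_right
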